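/- Let $\Gamma$ be a countable discrete abelian group, written additively, and let $\widehat\Gamma$ be its compact dual group with normalized Haar measure; write $(\gamma,\alpha)$ for the value of the character $\alpha\in\widehat\Gamma$ at $\gamma\in\Gamma$. Let $(\mathcal X,\mu)$ be a $\sigma$-finite measure space and $\sigma:\Gamma\times\mathcal X\to\mathcal X$, $\sigma_\gamma(x)=\sigma(\gamma,x)$, a measurable action. Suppose that $\sigma$ is quasi-$\Gamma$-invariant with Jacobian $J_\sigma$, i.e. $J_\sigma:\Gamma\times\mathcal X\to[0,\infty)$ is measurable and $\mu(\sigma_\gamma(E))=\int_E J_\sigma(\gamma,x)\,d\mu(x)$ for all $\gamma\in\Gamma$ and all measurable $E\subseteq\mathcal X$. Suppose also that $\sigma$ has the tiling property with tile $C$, i.e. $C\subseteq\mathcal X$ is measurable, $\mu(\mathcal X\setminus\bigcup_{\gamma}\sigma_\gamma(C))=0$ and $\mu(\sigma_\gamma(C)\cap\sigma_{\gamma'}(C))=0$ whenever $\gamma\ne\gamma'$. For $f\in L^2(\mathcal X)$ put $T_\sigma(\gamma)f(x)=J_\sigma(-\gamma,x)^{1/2}f(\sigma_{-\gamma}(x))$,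 and let $\mathcal T_\sigma:L^2(\mathcal X)\to L^2(\widehat\Gamma,L^2(C))$ be given by $$\mathcal T_\sigma[f](\alpha)=\sum_{\gamma\in\Gamma}(-\gamma,\alpha)\,\big(T_\sigma(\gamma)f\big)|_C ,$$ where the series converges in $L^2(\widehat\Gamma,L^2(C))$. For $\gamma\in\Gamma$ let $X_\gamma(\alpha)=(\gamma,\alpha)$. The length $\ell(M)$ of a set $M\subseteq L^2(\widehat\Gamma,L^2(C))$ is the least $n\in\{0,1,2,\dots\}$ for which there are $\Phi_1,\dots,\Phi_n\in M$ with $M=\overline{\mathrm{span}}\{X_\gamma\Phi_i:\gamma\in\Gamma,\,1\le i\le n\}$. For subspaces $S,T\subseteq\mathbb C^m$ let $$\mathcal G[S,T]=\sup\{|\langle x,y\rangle|: x\in S\cap(S\cap T)^\perp,\ y\in T\cap(S\cap T)^\perp,\ \|x\|=\|y\|=1\},$$ with $\mathcal G[S,T]=0$ if $S=\{0\}$, $T=\{0\}$, $S\subseteq T$ or $T\subseteq S$, and let $\mathcal F[S,T]=\sqrt{1-\mathcal G[S,T]^2}$ be the sine of the Friedrichs angle. A family $\{f_k\}$ in a closed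 subspace $V$ is a frame for $V$ if there are $0<a\le b$ with $a\|f\|^2\le\sum_k|\langle f,f_k\rangle|^2\le b\|f\|^2$ for all $f\in V$. Let $\phi_1,\dots,\phi_m\in L^2(\mathcal X)$, let $V=\overline{\mathrm{span}}\{T_\sigma(\gamma)\phi_j:\gamma\in\Gamma,\ 1\le j\le m\}$, let $M=\mathcal T_\sigma[V]$, and let $\ell(M)\le\ell\le m$. For $A=(a_{ij})\in\mathbb C^{\ell\times m}$ put $\psi_i=\sum_{j=1}^m a_{ij}\phi_j$, $1\le i\le\ell$, and let $\mathcal R$ be the set of all $A\in\mathbb C^{\ell\times m}$ with $V=\overline{\mathrm{span}}\{T_\sigma(\gamma)\psi_i:\gamma\in\Gamma,\ 1\le i\le\ell\}$. Then: 1. $\mathbb C^{\ell\times m}\setminus\mathcal R$ has Lebesgue measure zero. 2. If in addition $\{T_\sigma(\gamma)\phi_j:\gamma\in\Gamma,\ 1\le j\le m\}$ is a frame for $V$, then for every $A\in\mathbb C^{\ell\times m}$ the system $\{T_\sigma(\gamma)\psi_i:\gamma\in\Gamma,\ 1\le i\le\ell\}$ is a frame for $V$ if and only if $A\in\mathcal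 R$ and there is $\delta>0$ such that $\mathcal F[\mathrm{Ker}(A),\mathrm{Im}(G(\alpha))]\ge\delta$ for a.e. $\alpha\in\widehat\Gamma$, where $G(\alpha)\in\mathbb C^{m\times m}$ is the Gramian $G(\alpha)_{ij}=\langle\mathcal T_\sigma[\phi_i](\alpha),\mathcal T_\sigma[\phi_j](\alpha)\rangle$ (inner product linear in the first variable). -/

import Mathlib

open MeasureTheory
open scoped ENNReal NNReal

/-! Throughout, the discrete abelian group `Γ` is written multiplicatively, its dual `PontryaginDual Γ`
is the compact group of characters `α : Γ → Circle`, and the action `x ↦ γ • x` is the map `σ_γ`.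
Mathlib's `inner ℂ x y` is conjugate-linear in `x`, so the inner product `⟨x, y⟩` that is linear in
the first variable is `inner ℂ y x`. -/

noncomputable section

namespace TranslateSystem

section Hilbert

variable {E : Type*} [NormedAddCommGroup E] [InnerProductSpace ℂ E]

/-- The family `f`, all of whose members lie in `V`, is a frame for the closed subspace `V`:
`a ‖v‖² ≤ ∑ₖ |⟨v, f k⟩|² ≤ b ‖v‖²` for all `v ∈ V`, with `0 < a ≤ b`. -/
def IsFrameFor {ι : Type*} (V : Submodule ℂ E) (f : ι → E) : Prop :=
  (∀ k, f k ∈ V) ∧ ∃ a b : ℝ, 0 < a ∧ a ≤ b ∧ ∀ v ∈ V,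
    Summable (fun k => ‖inner ℂ (f k) v‖ ^ 2) ∧
    a * ‖v‖ ^ 2 ≤ ∑' k, ‖inner ℂ (f k) v‖ ^ 2 ∧
    ∑' k, ‖inner ℂ (f k) v‖ ^ 2 ≤ b * ‖v‖ ^ 2

/-- The cosine of the Friedrichs angle between `S` and `T`. If `S` or `T` is zero, or one of them
contains the other, the set below is empty and the value is `sSup ∅ = 0`, which is the usual
convention in these cases. -/
def friedrichsCos (S T : Submodule ℂ E) : ℝ :=
  sSup {c : ℝ | ∃ x ∈ S ⊓ (S ⊓ T)ᗮ, ∃ y ∈ T ⊓ (S ⊓ T)ᗮ,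
    ‖x‖ = 1 ∧ ‖y‖ = 1 ∧ c = ‖inner ℂ x y‖}

/-- The sine of the Friedrichs angle between `S` and `T`. -/
def friedrichsSin (S T : Submodule ℂ E) : ℝ :=
  Real.sqrt (1 - friedrichsCos S T ^ 2)

/-- The Gramian `G i j = ⟨x i, x j⟩`, for the inner product that is linear in the first variable. -/
def gramian {m : ℕ} (x : Fin m → E) : Matrix (Fin m) (Fin m) ℂ :=
  Matrix.of fun i j => inner ℂ (x j) (x i)

/-- The linear combinations `ψ i = ∑ j, A i j • φ j`. -/
def linComb {l m : ℕ} (A : Matrix (Fin l) (Fin m) ℂ) (φ : Fin m → E) : Fin l → E :=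
  fun i => ∑ j, A i j • φ j

end Hilbert

section Multiplicative

variable {Ω : Type*} [MeasurableSpace Ω] {ν : Measure Ω}
  {H : Type*} [NormedAddCommGroup H] [InnerProductSpace ℂ H]

/-- The closed span of `{g Φ i : g ∈ D, i}` in `L²(Ω, H)`, for `D ⊆ L^∞(Ω)`: the multiplicatively
invariant space generated by the family `Φ`. -/
def miSpan {ι : Type*} (D : Set (Lp ℂ ∞ ν)) (Φ : ι → Lp H 2 ν) : Submodule ℂ (Lp H 2 ν) :=
  (Submodule.span ℂ {F : Lp H 2 ν | ∃ g ∈ D, ∃ i, F = g • Φ i}).topologicalClosure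

/-- The length of `M ⊆ L²(Ω, H)`: the least number of elements of `M` that generate `M` as a
multiplicatively invariant space with respect to `D` (`⊤` if `M` is not finitely generated). -/
def miLength (D : Set (Lp ℂ ∞ ν)) (M : Set (Lp H 2 ν)) : ℕ∞ :=
  sInf {k : ℕ∞ | ∃ n : ℕ, k = n ∧ ∃ Φ : Fin n → Lp H 2 ν,
    (∀ i, Φ i ∈ M) ∧ M = (miSpan D Φ : Set (Lp H 2 ν))}

end Multiplicative

section Characters

variable {Γ : Type*} [CommGroup Γ] [TopologicalSpace Γ]
  [MeasurableSpace (PontryaginDual Γ)] [BorelSpace (PontryaginDual Γ)]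

theorem memLp_dualChar (ν : Measure (PontryaginDual Γ)) (γ : Γ) :
    MemLp (fun α : PontryaginDual Γ => ((α γ : Circle) : ℂ)) ∞ ν := by
  have hc : Continuous (fun α : PontryaginDual Γ => ((α γ : Circle) : ℂ)) := by
    have he : Continuous (fun z : Circle => (z : ℂ)) := by fun_prop
    exact he.comp <| (continuous_eval_const (F := C(Γ, Circle)) γ).comp
      (ContinuousMonoidHom.isInducing_toContinuousMap Γ Circle).continuous
  exact memLp_top_of_bound hc.aestronglyMeasurable 1 (Filter.Eventually.of_forall fun α => (Circle.norm_coe (α γ)).le)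

/-- The character `X_γ : α ↦ α γ` of the dual group, as an element of `L^∞`. -/
def dualChar (ν : Measure (PontryaginDual Γ)) (γ : Γ) : Lp ℂ ∞ ν :=
  (memLp_dualChar ν γ).toLp _

end Characters

section Action

variable {Γ : Type*} [CommGroup Γ] {X : Type*} [MeasurableSpace X] [MulAction Γ X]

/-- `J` is a Jacobian of the action: `dμ(σ_γ x) = J γ x dμ(x)`, that is,
`μ (σ_γ E) = ∫_E J γ dμ` for every measurable `E`. The action is quasi-invariant when it has one. -/
structure IsJacobian (μ : Measure X) (J : Γ → X → ℝ≥0) : Prop where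
  measurable : ∀ γ, Measurable (J γ)
  measure_image : ∀ (γ : Γ) (E : Set X), MeasurableSet E →
    μ ((fun x => γ • x) '' E) = ∫⁻ x in E, (J γ x : ℝ≥0∞) ∂μ

variable [MeasurableConstSMul Γ X] {μ : Measure X} {J : Γ → X → ℝ≥0}

theorem IsJacobian.map_withDensity (hJ : IsJacobian μ J) (γ : Γ) :
    (μ.withDensity fun x => (J γ x : ℝ≥0∞)).map (fun x => γ • x) = μ := by
  ext E hE
  have hs : MeasurableSet ((fun x : X => γ • x) ⁻¹' E) := measurable_const_smul γ hE
  rw [Measure.map_apply (measurable_const_smul γ) hE, withDensity_apply _ hs,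
    ← hJ.measure_image γ _ hs, Set.image_preimage_eq _ (MulAction.surjective γ)]

theorem IsJacobian.memLp_translate (hJ : IsJacobian μ J) (γ : Γ) (f : Lp ℂ 2 μ) :
    MemLp (fun x => ((Real.sqrt (J γ⁻¹ x) : ℝ) : ℂ) * f (γ⁻¹ • x)) 2 μ := by
  have hf : Measurable fun x => f (γ⁻¹ • x) :=
    (Lp.stronglyMeasurable f).measurable.comp (measurable_const_smul γ⁻¹)
  have hJm := hJ.measurable γ⁻¹
  refine ⟨(Measurable.mul (by fun_prop) hf).aestronglyMeasurable, ?_⟩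
  have h2 := (eLpNorm_lt_top_iff_lintegral_rpow_enorm_lt_top (μ := μ) (f := f)
    two_ne_zero ENNReal.ofNat_ne_top).1 (Lp.memLp f).2
  rw [eLpNorm_lt_top_iff_lintegral_rpow_enorm_lt_top two_ne_zero ENNReal.ofNat_ne_top]
  have h1 : ∀ g : X → ℝ≥0∞, ∫⁻ a, g a ∂μ =
      ∫⁻ a, g a ∂((μ.withDensity fun x => (J γ⁻¹ x : ℝ≥0∞)).map fun x => γ⁻¹ • x) := by
    intro g
    rw [hJ.map_withDensity γ⁻¹]
  rw [h1, lintegral_map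
    ((Lp.stronglyMeasurable f).measurable.enorm.pow_const _) (measurable_const_smul γ⁻¹),
    lintegral_withDensity_eq_lintegral_mul _ hJm.coe_nnreal_ennreal
      (hf.enorm.pow_const _)] at h2
  refine lt_of_le_of_lt (lintegral_mono fun x => le_of_eq ?_) h2
  have h3 : ‖((Real.sqrt (J γ⁻¹ x) : ℝ) : ℂ)‖ₑ ^ (2 : ℝ) = (J γ⁻¹ x : ℝ≥0∞) := by
    rw [← ofReal_norm, Complex.norm_real, Real.norm_of_nonneg (Real.sqrt_nonneg _),
      ENNReal.rpow_ofNat, ← ENNReal.ofReal_pow (Real.sqrt_nonneg _),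
      Real.sq_sqrt (NNReal.coe_nonneg _), ENNReal.ofReal_coe_nnreal]
  simp only [ENNReal.toReal_ofNat, Pi.mul_apply]
  rw [enorm_mul, ENNReal.mul_rpow_of_nonneg _ _ (by norm_num), h3]

/-- The operator `T_σ(γ) f (x) = J(γ⁻¹, x)^{1/2} f(σ_{γ⁻¹} x)` on `L²(X)`. -/
def translate (hJ : IsJacobian μ J) (γ : Γ) (f : Lp ℂ 2 μ) : Lp ℂ 2 μ :=
  (hJ.memLp_translate γ f).toLp _

/-- The system of translates `{T_σ(γ) φ j}`, indexed by the pairs `(γ, j)`. -/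
def system (hJ : IsJacobian μ J) {m : ℕ} (φ : Fin m → Lp ℂ 2 μ) : Γ × Fin m → Lp ℂ 2 μ :=
  fun p => translate hJ p.1 (φ p.2)

/-- The closed span of the system of translates of `φ`. -/
def invariantSpan (hJ : IsJacobian μ J) {m : ℕ} (φ : Fin m → Lp ℂ 2 μ) : Submodule ℂ (Lp ℂ 2 μ) :=
  (Submodule.span ℂ (Set.range (system hJ φ))).topologicalClosure

/-- The set `R` of the `l × m` matrices `A` for which the linear combinations given by `A`
generate the same invariant space as `φ`. -/
def generatingMatrices (hJ : IsJacobian μ J) (l : ℕ) {m : ℕ} (φ : Fin m → Lp ℂ 2 μ) :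
    Set (Matrix (Fin l) (Fin m) ℂ) :=
  {A | invariantSpan hJ (linComb A φ) = invariantSpan hJ φ}

variable [TopologicalSpace Γ]
  [MeasurableSpace (PontryaginDual Γ)] [BorelSpace (PontryaginDual Γ)]

/-- The fiberization map `L²(X) → L²(Γ̂, L²(C))`,
`𝒯 ψ (α) (x) = ∑_γ (T_σ(γ) ψ)(x) α(γ⁻¹)` for `x ∈ C`. The series converges in `L²(Γ̂, L²(C))`: if the
translates of `C` tile `X` and `ν` is the normalized Haar measure, its terms are pairwise
orthogonal and the squares of their norms add up to `‖ψ‖²`. -/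
def fiberMap (ν : Measure (PontryaginDual Γ)) [IsFiniteMeasure ν] (hJ : IsJacobian μ J) (C : Set X)
    (ψ : Lp ℂ 2 μ) : Lp (Lp ℂ 2 (μ.restrict C)) 2 ν :=
  ∑' γ : Γ, (dualChar ν γ⁻¹ •
    Lp.const 2 ν (LpToLpRestrictCLM X ℂ ℂ μ 2 C (translate hJ γ ψ)) :
      Lp (Lp ℂ 2 (μ.restrict C)) 2 ν)

end Action

end TranslateSystem

end

/-! Fiberization turns the problem into finite-dimensional linear algebra over each `α`. Tiling
makes the series for `fiberMap` orthogonal with squared norms adding up to `‖f‖ ^ 2`, so it is an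
isometry, and it carries translation by `γ` to multiplication by a character. Hence `V` becomes a
multiplicatively invariant space, and membership in such a space is decided fiberwise: `F α` must
lie in the span of the `Φ i α` for a.e. `α` (`mem_miSpan_iff`).

For vectors `x` with Gramian `G`, the vectors `coeffs x v`, `v ∈ span x`, fill out `Im G`, and `A`
maps `coeffs x v` to `coeffs (linComb A x) v`. So `linComb A x` has the same span as `x` iff `Ker A
∩ Im G = 0`, iff `rank (A G) = rank G`.

Part 1: length at most `l` forces `rank G(α) ≤ l`; for one such `G` almost every `A` is injective on
`Im G`; Fubini exchanges "for a.e. `α`" and "for a.e. `A`".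

Part 2: by Parseval the frame sum of `f` is the integral of the fiberwise `‖coeffs‖ ^ 2`, so frame
bounds are uniform fiberwise bounds. If `φ` gives a frame, `‖coeffs‖` is uniformly comparable to
`‖v‖`, and the lower bound for `ψ` says that `‖A y‖ ^ 2 ≥ c ‖y‖ ^ 2` on `Im G(α)` with `c`
independent of `α`. Given the trivial intersection, this is a uniform lower bound on the angle. The
upper bound is automatic, since the fibers of `φ` are bounded. -/

noncomputable section

namespace TranslateSystem

/-! ### Friedrichs angle and lower bounds of a linear map on a subspace -/

section Friedrichs

variable {E F : Type*} [NormedAddCommGroup E] [InnerProductSpace ℂ E]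
  [NormedAddCommGroup F] [InnerProductSpace ℂ F]

theorem friedrichsCos_nonneg (S W : Submodule ℂ E) : 0 ≤ friedrichsCos S W := by
  apply Real.sSup_nonneg
  rintro c ⟨x, -, y, -, -, -, rfl⟩
  positivity

theorem norm_inner_le_friedrichsCos {S W : Submodule ℂ E} (h : S ⊓ W = ⊥) {x y : E}
    (hx : x ∈ S) (hy : y ∈ W) : ‖inner ℂ x y‖ ≤ friedrichsCos S W * ‖x‖ * ‖y‖ := by
  by_cases hx0 : x = 0
  · simp [hx0]
  by_cases hy0 : y = 0
  · simp [hy0]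
  have hx1 : ‖x‖ ≠ 0 := norm_ne_zero_iff.2 hx0
  have hy1 : ‖y‖ ≠ 0 := norm_ne_zero_iff.2 hy0
  have hxp := norm_pos_iff.2 hx0
  have hyp := norm_pos_iff.2 hy0
  have hb : BddAbove {c : ℝ | ∃ x ∈ S ⊓ (S ⊓ W)ᗮ, ∃ y ∈ W ⊓ (S ⊓ W)ᗮ,
      ‖x‖ = 1 ∧ ‖y‖ = 1 ∧ c = ‖inner ℂ x y‖} := by
    refine ⟨1, ?_⟩
    rintro c ⟨x, -, y, -, hx, hy, rfl⟩
    simpa [hx, hy] using norm_inner_le_norm (𝕜 := ℂ) x y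
  have key : ‖inner ℂ (((‖x‖⁻¹ : ℝ) : ℂ) • x) (((‖y‖⁻¹ : ℝ) : ℂ) • y)‖ ≤ friedrichsCos S W := by
    refine le_csSup hb ⟨_, ⟨S.smul_mem _ hx, ?_⟩, _, ⟨W.smul_mem _ hy, ?_⟩, ?_, ?_, rfl⟩
    · simp [h]
    · simp [h]
    · simp [norm_smul, hx1]
    · simp [norm_smul, hy1]
  rw [inner_smul_left, inner_smul_right] at key
  simp only [norm_mul, Complex.norm_conj, Complex.norm_real, norm_inv, norm_norm] at key
  calc ‖inner ℂ x y‖ = (‖x‖⁻¹ * (‖y‖⁻¹ * ‖inner ℂ x y‖)) * ‖x‖ * ‖y‖ := by field_simp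
    _ ≤ _ := by gcongr

/-- `T` is bounded below on `(ker T)ᗮ`, and the angle keeps a fixed fraction of each `y ∈ W` in that
complement. The constant does not depend on `W`, so it serves all fibers at once. -/
theorem exists_norm_sq_le_of_le_friedrichsSin [FiniteDimensional ℂ E] (T : E →ₗ[ℂ] F)
    {δ : ℝ} (hδ : 0 < δ) : ∃ c : ℝ, 0 < c ∧ ∀ W : Submodule ℂ E, LinearMap.ker T ⊓ W = ⊥ →
      δ ≤ friedrichsSin (LinearMap.ker T) W → ∀ y ∈ W, c * ‖y‖ ^ 2 ≤ ‖T y‖ ^ 2 := by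
  obtain ⟨K, hK, hT⟩ := (T.domRestrict (LinearMap.ker T)ᗮ).exists_antilipschitzWith (by
    rw [LinearMap.ker_eq_bot']
    rintro ⟨z, hz⟩ h
    have hz' : z ∈ LinearMap.ker T := h
    have := Submodule.inner_right_of_mem_orthogonal hz' hz
    simpa using this)
  refine ⟨δ ^ 2 / K ^ 2, by positivity, fun W hW hsin y hy => ?_⟩
  set S := LinearMap.ker T
  have hcos : friedrichsCos S W ^ 2 ≤ 1 - δ ^ 2 := by
    -- `δ > 0` excludes the value `0` that `Real.sqrt` takes on nonpositive numbers.
    have h1 : 0 < 1 - friedrichsCos S W ^ 2 := Real.sqrt_pos.1 (hδ.trans_le hsin)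
    have := (Real.le_sqrt hδ.le h1.le).1 hsin
    linarith
  obtain ⟨p, hp, z, hz, rfl⟩ := S.exists_add_mem_mem_orthogonal y
  have hpz : inner ℂ p z = 0 := Submodule.inner_right_of_mem_orthogonal hp hz
  have hsum : ‖p + z‖ ^ 2 = ‖p‖ ^ 2 + ‖z‖ ^ 2 := by
    have := norm_add_sq_eq_norm_sq_add_norm_sq_of_inner_eq_zero p z hpz
    simpa [sq] using this
  have h2 := norm_inner_le_friedrichsCos hW hp hy
  -- Testing the angle on `p` and `y = p + z` gives `‖p‖ ≤ cos * ‖y‖`.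
  have h3 : ‖inner ℂ p (p + z)‖ = ‖p‖ ^ 2 := by
    rw [inner_add_right, hpz, add_zero, inner_self_eq_norm_sq_to_K]
    simp
  rw [h3] at h2
  have h4 : ‖p‖ ≤ friedrichsCos S W * ‖p + z‖ := by
    by_cases hp0 : ‖p‖ = 0
    · rw [hp0]; exact mul_nonneg (friedrichsCos_nonneg _ _) (norm_nonneg _)
    · have : 0 < ‖p‖ := lt_of_le_of_ne (norm_nonneg _) (Ne.symm hp0)
      nlinarith
  have h5 : ‖p‖ ^ 2 ≤ (1 - δ ^ 2) * ‖p + z‖ ^ 2 := by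
    calc ‖p‖ ^ 2 ≤ (friedrichsCos S W * ‖p + z‖) ^ 2 := by gcongr
      _ = friedrichsCos S W ^ 2 * ‖p + z‖ ^ 2 := by ring
      _ ≤ _ := by gcongr
  have h6 : ‖z‖ ≤ K * ‖T z‖ := by
    have := hT.le_mul_norm (map_zero _) (⟨z, hz⟩ : Sᗮ)
    simpa using this
  have h7 : T (p + z) = T z := by
    rw [map_add, LinearMap.mem_ker.1 hp, zero_add]
  rw [h7, div_mul_eq_mul_div, div_le_iff₀ (by positivity)]
  have h8 : ‖z‖ ^ 2 ≤ (K * ‖T z‖) ^ 2 := by gcongr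
  nlinarith

/-- For unit `x ∈ ker T`, `y ∈ W` and `r = ⟪x, y⟫`, removing `r • x` from `y` does not change `T y`
and leaves a vector of squared norm `1 - ‖r‖ ^ 2`; so `c ≤ ‖T‖ ^ 2 * (1 - ‖r‖ ^ 2)`. -/
theorem exists_le_friedrichsSin_of_norm_sq_le [FiniteDimensional ℂ E] (T : E →ₗ[ℂ] F)
    {c : ℝ} (hc : 0 < c) : ∃ δ : ℝ, 0 < δ ∧ ∀ W : Submodule ℂ E,
      (∀ y ∈ W, c * ‖y‖ ^ 2 ≤ ‖T y‖ ^ 2) → δ ≤ friedrichsSin (LinearMap.ker T) W := by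
  -- The summand `c` gives `K > 0` and `c / K ≤ 1`, even for `T = 0`.
  set K : ℝ := ‖T.toContinuousLinearMap‖ ^ 2 + c
  have hK : 0 < K := by positivity
  refine ⟨Real.sqrt (c / K), by positivity, fun W hW => ?_⟩
  apply Real.sqrt_le_sqrt
  have hcK : c / K ≤ 1 := by
    rw [div_le_one hK]
    simp only [K]
    nlinarith [sq_nonneg ‖T.toContinuousLinearMap‖]
  suffices friedrichsCos (LinearMap.ker T) W ≤ Real.sqrt (1 - c / K) by
    have h1 := pow_le_pow_left₀ (friedrichsCos_nonneg _ _) this 2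
    rw [Real.sq_sqrt (by linarith)] at h1
    linarith
  apply Real.sSup_le _ (Real.sqrt_nonneg _)
  rintro _ ⟨x, hx, y, hy, hx1, hy1, rfl⟩
  apply Real.le_sqrt_of_sq_le
  set r : ℂ := inner ℂ x y with hr
  have h1 : ‖y - r • x‖ ^ 2 = 1 - ‖r‖ ^ 2 := by
    rw [@norm_sub_sq ℂ, inner_smul_right, ← inner_conj_symm, ← hr, norm_smul, hx1, hy1,
      Complex.mul_conj, Complex.normSq_eq_norm_sq]
    simp only [RCLike.re_to_complex, Complex.ofReal_re]
    ring
  have h2 : T (y - r • x) = T y := by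
    rw [map_sub, map_smul, LinearMap.mem_ker.1 hx.1, smul_zero, sub_zero]
  have h3 := hW y hy.1
  have h4 : ‖T y‖ ≤ ‖T.toContinuousLinearMap‖ * ‖y - r • x‖ := by
    rw [← h2]
    exact T.toContinuousLinearMap.le_opNorm (y - r • x)
  have h5 : ‖T y‖ ^ 2 ≤ (‖T.toContinuousLinearMap‖ * ‖y - r • x‖) ^ 2 := by gcongr
  rw [mul_pow, h1] at h5
  rw [hy1] at h3
  have h6 : 0 ≤ 1 - ‖r‖ ^ 2 := h1 ▸ sq_nonneg _
  have h7 : c / K ≤ 1 - ‖r‖ ^ 2 := by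
    rw [div_le_iff₀ hK]
    simp only [K]
    nlinarith
  linarith

end Friedrichs

/-! ### Coefficient vectors and the range of the Gramian -/

section Gramian

variable {E : Type*} [NormedAddCommGroup E] [InnerProductSpace ℂ E] {l m : ℕ}

/-- The vector of the coefficients `⟨x i, v⟩`, for the inner product that is linear in the first
variable. -/
def coeffs (x : Fin m → E) (v : E) : EuclideanSpace ℂ (Fin m) :=
  WithLp.toLp 2 fun i => inner ℂ v (x i)

theorem norm_sq_coeffs (x : Fin m → E) (v : E) :
    ‖coeffs x v‖ ^ 2 = ∑ i, ‖inner ℂ (x i) v‖ ^ 2 := by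
  simp [coeffs, EuclideanSpace.norm_sq_eq, norm_inner_symm]

theorem toEuclideanLin_coeffs (A : Matrix (Fin l) (Fin m) ℂ) (x : Fin m → E) (v : E) :
    Matrix.toEuclideanLin A (coeffs x v) = coeffs (linComb A x) v := by
  ext i
  simp [coeffs, linComb, Matrix.toLpLin_apply, Matrix.mulVec, dotProduct]

theorem coeffs_sum_eq (x : Fin m → E) (c : Fin m → ℂ) :
    coeffs x (∑ j, c j • x j) = Matrix.toEuclideanLin (gramian x) (WithLp.toLp 2 (star c)) := by
  ext i
  simp [coeffs, gramian, Matrix.toLpLin_apply, Matrix.mulVec, dotProduct]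

/-- `coeffs` is conjugate-linear in the vector, so the coefficients enter through `star c`;
conjugation is a bijection, so the range is unaffected. -/
theorem mem_range_gramian_iff (x : Fin m → E) (y : EuclideanSpace ℂ (Fin m)) :
    y ∈ LinearMap.range (Matrix.toEuclideanLin (gramian x)) ↔
      ∃ c : Fin m → ℂ, coeffs x (∑ j, c j • x j) = y := by
  constructor
  · rintro ⟨d, rfl⟩
    exact ⟨star d.ofLp, by rw [coeffs_sum_eq, star_star]⟩
  · rintro ⟨c, rfl⟩
    exact ⟨_, (coeffs_sum_eq x c).symm⟩

theorem coeffs_eq_zero_iff (x : Fin m → E) (v : E) :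
    coeffs x v = 0 ↔ v ∈ (Submodule.span ℂ (Set.range x))ᗮ := by
  rw [Submodule.mem_orthogonal']
  constructor
  · intro h u hu
    induction hu using Submodule.span_induction with
    | mem _ h' =>
      obtain ⟨i, rfl⟩ := h'
      exact congrArg (fun z : EuclideanSpace ℂ (Fin m) => z i) h
    | zero => simp
    | add a b _ _ ha hb => rw [inner_add_right, ha, hb, add_zero]
    | smul c a _ ha => rw [inner_smul_right, ha, mul_zero]
  · intro h
    ext i
    exact h _ (Submodule.subset_span ⟨i, rfl⟩)

theorem linComb_mem_span (A : Matrix (Fin l) (Fin m) ℂ) (x : Fin m → E) (i : Fin l) :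
    linComb A x i ∈ Submodule.span ℂ (Set.range x) :=
  Submodule.sum_mem _ fun j _ => Submodule.smul_mem _ _ (Submodule.subset_span ⟨j, rfl⟩)

theorem span_linComb_le (A : Matrix (Fin l) (Fin m) ℂ) (x : Fin m → E) :
    Submodule.span ℂ (Set.range (linComb A x)) ≤ Submodule.span ℂ (Set.range x) :=
  Submodule.span_le.2 (Set.range_subset_iff.2 (linComb_mem_span A x))

/-- A vector of `span x` orthogonal to every `linComb A x i` has its coefficients in `Ker A ∩ Im G`,
and `coeffs x` is injective on `span x`. -/
theorem ker_inf_range_gramian_eq_bot_iff (A : Matrix (Fin l) (Fin m) ℂ) (x : Fin m → E) :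
    LinearMap.ker (Matrix.toEuclideanLin A) ⊓
        LinearMap.range (Matrix.toEuclideanLin (gramian x)) = ⊥ ↔
      Submodule.span ℂ (Set.range (linComb A x)) = Submodule.span ℂ (Set.range x) := by
  constructor
  · intro h
    refine le_antisymm (span_linComb_le A x) fun v hv => ?_
    have : FiniteDimensional ℂ (Submodule.span ℂ (Set.range (linComb A x))) :=
      FiniteDimensional.span_of_finite ℂ (Set.finite_range _)
    obtain ⟨p, hp, z, hz, rfl⟩ :=
      (Submodule.span ℂ (Set.range (linComb A x))).exists_add_mem_mem_orthogonal v
    have hz' : z ∈ Submodule.span ℂ (Set.range x) := by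
      simpa using Submodule.sub_mem _ hv (span_linComb_le A x hp)
    obtain ⟨c, hc⟩ := (Submodule.mem_span_range_iff_exists_fun ℂ).1 hz'
    have h1 : coeffs x z ∈ LinearMap.ker (Matrix.toEuclideanLin A) ⊓
        LinearMap.range (Matrix.toEuclideanLin (gramian x)) := by
      refine ⟨?_, (mem_range_gramian_iff x _).2 ⟨c, by rw [hc]⟩⟩
      rw [SetLike.mem_coe, LinearMap.mem_ker, toEuclideanLin_coeffs]
      exact (coeffs_eq_zero_iff _ _).2 hz
    rw [h, Submodule.mem_bot, coeffs_eq_zero_iff] at h1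
    have h2 : z = 0 := by simpa using Submodule.inner_right_of_mem_orthogonal hz' h1
    rw [h2, add_zero]
    exact hp
  · intro h
    rw [eq_bot_iff]
    rintro y ⟨hy, hy'⟩
    obtain ⟨c, rfl⟩ := (mem_range_gramian_iff x y).1 hy'
    have hy2 : Matrix.toEuclideanLin A (coeffs x (∑ j, c j • x j)) = 0 := hy
    rw [toEuclideanLin_coeffs, coeffs_eq_zero_iff, h] at hy2
    exact (coeffs_eq_zero_iff _ _).2 hy2

/-- Expanding `x` in `w` factors the Gramian through `ℂ^n`. -/
theorem rank_gramian_le {n : ℕ} (x : Fin m → E) (w : Fin n → E)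
    (h : ∀ j, x j ∈ Submodule.span ℂ (Set.range w)) : (gramian x).rank ≤ n := by
  choose b hb using fun j => (Submodule.mem_span_range_iff_exists_fun ℂ).1 (h j)
  have : gramian x = Matrix.of b * Matrix.of fun k j => inner ℂ (x j) (w k) := by
    ext i j
    simp only [gramian, Matrix.of_apply, Matrix.mul_apply]
    rw [← hb i, inner_sum]
    simp [inner_smul_right]
  rw [this]
  exact (Matrix.rank_mul_le_left _ _).trans ((Matrix.rank_le_width _))

end Gramian

/-! ### Generic matrices are injective on a range of small dimension -/

section GenericMatrices

variable {l m n : ℕ}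

theorem isOpen_setOf_le_rank (k : ℕ) :
    IsOpen {M : Fin l → Fin m → ℂ | k ≤ (Matrix.of M).rank} := by
  let L : (Fin l → Fin m → ℂ) →ₗ[ℂ] ((Fin m → ℂ) →L[ℂ] (Fin l → ℂ)) :=
    (LinearMap.toContinuousLinearMap.toLinearMap ∘ₗ Matrix.toLin'.toLinearMap) ∘ₗ
      (Matrix.ofLinearEquiv ℂ).toLinearMap
  have hL : Continuous L := L.continuous_of_finiteDimensional
  convert (isOpen_setOfPred_nat_le_rank (𝕜 := ℂ) (E := Fin m → ℂ) (F := Fin l → ℂ) k).preimage hL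
    using 1
  ext M
  have h1 : ((L M : (Fin m → ℂ) →L[ℂ] (Fin l → ℂ)) : (Fin m → ℂ) →ₗ[ℂ] (Fin l → ℂ)) =
      Matrix.mulVecLin (Matrix.of M) := rfl
  simp only [Set.mem_ofPred_eq, Set.mem_preimage]
  rw [h1, LinearMap.rank, ← Module.finrank_eq_rank, Nat.cast_le]
  rfl

theorem rank_eq_finrank_range_toEuclideanLin (A : Matrix (Fin l) (Fin m) ℂ) :
    A.rank = Module.finrank ℂ (LinearMap.range (Matrix.toEuclideanLin A)) := by
  rw [Matrix.toEuclideanLin, Matrix.toLpLin_eq_toLin]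
  exact Matrix.rank_eq_finrank_range_toLin A _ _

/-- Rank-nullity for `A` on `Im G`. The rank form is what gives measurability, as rank is lower
semicontinuous. -/
theorem ker_inf_range_eq_bot_iff_rank (A : Matrix (Fin l) (Fin m) ℂ)
    (G : Matrix (Fin m) (Fin n) ℂ) :
    LinearMap.ker (Matrix.toEuclideanLin A) ⊓ LinearMap.range (Matrix.toEuclideanLin G) = ⊥ ↔
      G.rank ≤ (A * G).rank := by
  have h0 : Matrix.toEuclideanLin (A * G) = Matrix.toEuclideanLin A ∘ₗ Matrix.toEuclideanLin G := by
    ext v : 1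
    simp [Matrix.toLpLin_apply]
  rw [rank_eq_finrank_range_toEuclideanLin, rank_eq_finrank_range_toEuclideanLin, h0,
    LinearMap.range_comp]
  set T := Matrix.toEuclideanLin A
  set W := LinearMap.range (Matrix.toEuclideanLin G)
  have h1 := LinearMap.finrank_range_add_finrank_ker (T.domRestrict W)
  rw [LinearMap.range_domRestrict, LinearMap.ker_domRestrict] at h1
  rw [inf_comm, ← disjoint_iff, Submodule.disjoint_iff_comap_eq_bot, ← Submodule.finrank_eq_zero]
  omega

/-- A generic matrix is injective on the range of a fixed matrix of rank at most `l`. -/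
theorem ae_rank_le_rank_mul (G : Matrix (Fin m) (Fin n) ℂ) (hG : G.rank ≤ l) :
    ∀ᵐ A : Fin l → Fin m → ℂ, G.rank ≤ (Matrix.of A * G).rank := by
  set W := LinearMap.range (Matrix.toEuclideanLin G)
  have hWl : Module.finrank ℂ W ≤ Module.finrank ℂ (EuclideanSpace ℂ (Fin l)) := by
    rw [finrank_euclideanSpace_fin]
    rwa [rank_eq_finrank_range_toEuclideanLin] at hG
  -- Since `dim W ≤ l`, some matrix `B` is injective on `W`; `P` is a left inverse of its
  -- restriction `f`.
  obtain ⟨f, hf⟩ := finrank_le_iff_exists_linearMap.1 hWl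
  obtain ⟨g, hg⟩ := LinearMap.exists_extend f
  obtain ⟨P, hP⟩ := LinearMap.exists_leftInverse_of_injective f (LinearMap.ker_eq_bot.2 hf)
  obtain ⟨B, rfl⟩ := Matrix.toEuclideanLin.surjective g
  have hcont : Continuous fun A : Fin l → Fin m → ℂ =>
      (Matrix.of.symm (Matrix.of A * G) : Fin l → Fin n → ℂ) := by
    have : Continuous fun A : Matrix (Fin l) (Fin m) ℂ => A * G := by fun_prop
    exact this
  set U : Set (Fin l → Fin m → ℂ) := {A | G.rank ≤ (Matrix.of A * G).rank} with hU
  have hUo : IsOpen U := (isOpen_setOf_le_rank G.rank).preimage hcont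
  set B' : Fin l → Fin m → ℂ := Matrix.of.symm B
  -- If `A + t B` kills a nonzero `y ∈ W`, then applying `P` shows that `-t` is an eigenvalue of `P
  -- A` on `W`; so each line in direction `B` has finitely many bad `t`.
  have hline : ∀ A : Fin l → Fin m → ℂ, ∀ᵐ t : ℂ, A + t • B' ∈ U := by
    intro A
    let Q : Module.End ℂ W := P ∘ₗ (Matrix.toEuclideanLin (Matrix.of A)).domRestrict W
    have hfin : {t : ℂ | -t ∈ {s | Q.HasEigenvalue s}}.Finite :=
      Set.Finite.preimage neg_injective.injOn Q.finite_hasEigenvalue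
    filter_upwards [(hfin.countable.ae_notMem volume)] with t ht
    simp only [hU, Set.mem_ofPred_eq]
    rw [← ker_inf_range_eq_bot_iff_rank, eq_bot_iff]
    rintro y ⟨hy1, hy2⟩
    by_contra hy0
    apply ht
    refine Module.End.hasEigenvalue_of_hasEigenvector (x := ⟨y, hy2⟩) ?_
    rw [Module.End.hasEigenvector_iff, Module.End.mem_eigenspace_iff]
    refine ⟨?_, fun h => hy0 (congrArg Subtype.val h)⟩
    have h1 : Matrix.toEuclideanLin (Matrix.of A) y + t • Matrix.toEuclideanLin B y = 0 := by
      have h2 : Matrix.of (A + t • B') = Matrix.of A + t • B := rfl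
      rw [SetLike.mem_coe, LinearMap.mem_ker, h2, map_add, map_smul] at hy1
      exact hy1
    have h3 : Matrix.toEuclideanLin B y = f ⟨y, hy2⟩ := by rw [← hg]; rfl
    have h4 : P (f ⟨y, hy2⟩) = ⟨y, hy2⟩ := LinearMap.congr_fun hP _
    have h5 := congrArg P h1
    rw [map_add, map_smul, map_zero, h3, h4] at h5
    rw [neg_smul]
    exact eq_neg_of_add_eq_zero_left h5
  have hmeas : MeasurableSet {p : (Fin l → Fin m → ℂ) × ℂ | p.1 + p.2 • B' ∈ U} :=
    hUo.measurableSet.preimage (by fun_prop)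
  -- Fubini yields one `t` that is good for a.e. `A`; translation invariance of Lebesgue measure
  -- then removes `t B`.
  obtain ⟨t, ht⟩ := ((Measure.ae_ae_comm (μ := volume) (ν := volume) (p := fun A t => A + t • B' ∈ U) hmeas).1
    (Filter.Eventually.of_forall hline)).exists
  have h := (measurePreserving_add_right volume (-(t • B'))).quasiMeasurePreserving.ae ht
  simpa [hU] using h

theorem measurableSet_rank_le_rank_mul :
    MeasurableSet {p : (Fin l → Fin m → ℂ) × (Fin m → Fin n → ℂ) |
      (Matrix.of p.2).rank ≤ (Matrix.of p.1 * Matrix.of p.2).rank} := by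
  have h1 : Measurable fun p : (Fin l → Fin m → ℂ) × (Fin m → Fin n → ℂ) =>
      (Matrix.of p.2).rank :=
    measurable_of_Ici fun k => ((isOpen_setOf_le_rank k).preimage continuous_snd).measurableSet
  have h2 : Measurable fun p : (Fin l → Fin m → ℂ) × (Fin m → Fin n → ℂ) =>
      (Matrix.of p.1 * Matrix.of p.2).rank := by
    have hcont : Continuous fun p : (Fin l → Fin m → ℂ) × (Fin m → Fin n → ℂ) =>
        (Matrix.of.symm (Matrix.of p.1 * Matrix.of p.2) : Fin l → Fin n → ℂ) := by
      have : Continuous fun p : Matrix (Fin l) (Fin m) ℂ × Matrix (Fin m) (Fin n) ℂ =>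
        p.1 * p.2 := by fun_prop
      exact this
    exact measurable_of_Ici fun k => ((isOpen_setOf_le_rank k).preimage hcont).measurableSet
  exact measurableSet_le h1 h2

theorem ae_ae_rank_le_rank_mul {Ω : Type*} [MeasurableSpace Ω] (ν : Measure Ω) [SFinite ν]
    {G : Ω → Matrix (Fin m) (Fin n) ℂ} (hGm : ∀ i j, Measurable fun ω => G ω i j)
    (hG : ∀ᵐ ω ∂ν, (G ω).rank ≤ l) :
    ∀ᵐ A : Fin l → Fin m → ℂ, ∀ᵐ ω ∂ν, (G ω).rank ≤ (Matrix.of A * G ω).rank := by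
  have hm : Measurable fun p : (Fin l → Fin m → ℂ) × Ω =>
      (p.1, (Matrix.of.symm (G p.2) : Fin m → Fin n → ℂ)) := by
    refine measurable_fst.prodMk (measurable_pi_lambda _ fun i => measurable_pi_lambda _ fun j => ?_)
    exact (hGm i j).comp measurable_snd
  refine (Measure.ae_ae_comm (p := fun (A : Fin l → Fin m → ℂ) ω =>
    (G ω).rank ≤ (Matrix.of A * G ω).rank) (hm measurableSet_rank_le_rank_mul)).2 ?_
  filter_upwards [hG] with ω hω
  exact ae_rank_le_rank_mul (G ω) hω

end GenericMatrices

/-! ### Fourier analysis on the dual group -/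

section DualGroup

variable {Γ : Type*} [CommGroup Γ] [TopologicalSpace Γ]

/-- The character `α ↦ α γ` of the dual group as a continuous function. -/
def dualCharMap (γ : Γ) : C(PontryaginDual Γ, ℂ) where
  toFun α := ((α γ : Circle) : ℂ)
  continuous_toFun := by
    have he : Continuous (fun z : Circle => (z : ℂ)) := by fun_prop
    exact he.comp <| (continuous_eval_const (F := C(Γ, Circle)) γ).comp
      (ContinuousMonoidHom.isInducing_toContinuousMap Γ Circle).continuous

@[simp]
theorem dualCharMap_apply (γ : Γ) (α : PontryaginDual Γ) :
    dualCharMap γ α = ((α γ : Circle) : ℂ) := rfl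

theorem norm_dualCharMap (γ : Γ) (α : PontryaginDual Γ) : ‖dualCharMap γ α‖ = 1 :=
  Circle.norm_coe (α γ)

theorem dualCharMap_one (α : PontryaginDual Γ) : dualCharMap (1 : Γ) α = 1 := by simp

theorem dualCharMap_mul (γ γ' : Γ) (α : PontryaginDual Γ) :
    dualCharMap (γ * γ') α = dualCharMap γ α * dualCharMap γ' α := by simp

theorem dualCharMap_inv (γ : Γ) (α : PontryaginDual Γ) :
    dualCharMap γ⁻¹ α = (starRingEnd ℂ) (dualCharMap γ α) := by
  rw [dualCharMap_apply, map_inv]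
  exact Circle.coe_inv_eq_conj (α γ)

variable (Γ) in
/-- The trigonometric polynomials on the dual group. -/
def trigPolynomials : StarSubalgebra ℂ C(PontryaginDual Γ, ℂ) where
  toSubalgebra := Algebra.adjoin ℂ (Set.range (dualCharMap (Γ := Γ)))
  star_mem' := by
    change Algebra.adjoin ℂ (Set.range (dualCharMap (Γ := Γ))) ≤
      star (Algebra.adjoin ℂ (Set.range (dualCharMap (Γ := Γ))))
    refine Algebra.adjoin_le ?_
    rintro - ⟨γ, rfl⟩
    exact Algebra.subset_adjoin ⟨γ⁻¹, ContinuousMap.ext fun α => dualCharMap_inv γ α⟩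

theorem trigPolynomials_toSubmodule :
    Subalgebra.toSubmodule (trigPolynomials Γ).toSubalgebra =
      Submodule.span ℂ (Set.range (dualCharMap (Γ := Γ))) := by
  apply Algebra.adjoin_eq_span_of_subset
  refine Set.Subset.trans ?_ Submodule.subset_span
  intro x hx
  refine Submonoid.closure_induction (fun _ => id) ⟨1, ?_⟩ ?_ hx
  · ext1 α
    exact dualCharMap_one α
  · rintro - - - - ⟨γ, rfl⟩ ⟨γ', rfl⟩
    exact ⟨γ * γ', ContinuousMap.ext fun α => dualCharMap_mul γ γ' α⟩

variable [DiscreteTopology Γ]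

theorem topologicalClosure_trigPolynomials : (trigPolynomials Γ).topologicalClosure = ⊤ := by
  refine ContinuousMap.starSubalgebra_topologicalClosure_eq_top_of_separatesPoints _ ?_
  intro α β hαβ
  obtain ⟨γ, hγ⟩ : ∃ γ, α γ ≠ β γ := by
    by_contra! h
    exact hαβ (PontryaginDual.ext h)
  exact ⟨dualCharMap γ, ⟨_, Algebra.subset_adjoin ⟨γ, rfl⟩, rfl⟩,
    fun h => hγ (Subtype.ext h)⟩

/-- The characters of a discrete group separate its points. -/
theorem exists_dualCharMap_ne_one {γ : Γ} (hγ : γ ≠ 1) :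
    ∃ α : PontryaginDual Γ, dualCharMap γ α ≠ 1 := by
  obtain ⟨c, hc⟩ := CharacterModule.exists_character_apply_ne_zero_of_ne_zero
    (A := Additive Γ) (a := Additive.ofMul γ) hγ
  have : Fact ((0 : ℝ) < 1) := ⟨one_pos⟩
  -- The separating character takes values in `ℚ/ℤ`; the embedding into `ℝ/ℤ` turns it into a
  -- circle-valued one.
  let i : AddCircle (1 : ℚ) →+ AddCircle (1 : ℝ) :=
    QuotientAddGroup.map _ _ (Rat.castHom ℝ).toAddMonoidHom (by
      rintro x hx
      obtain ⟨n, rfl⟩ := AddSubgroup.mem_zmultiples_iff.1 hx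
      exact AddSubgroup.mem_zmultiples_iff.2 ⟨n, by simp⟩)
  have hi : ∀ x, i x = 0 → x = 0 := by
    intro x
    induction x using QuotientAddGroup.induction_on with
    | H q =>
      intro h
      have h' : ((q : ℝ) : AddCircle (1 : ℝ)) = 0 := h
      obtain ⟨n, hn⟩ := (AddCircle.coe_eq_zero_iff _).1 h'
      refine (AddCircle.coe_eq_zero_iff _).2 ⟨n, ?_⟩
      simp only [zsmul_eq_mul, mul_one] at hn ⊢
      exact_mod_cast hn
  let f : Γ →* Circle :=
    { toFun := fun g => AddCircle.toCircle (i (c (Additive.ofMul g)))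
      map_one' := by
        simp
      map_mul' := fun a b => by
        have : c (Additive.ofMul (a * b)) = c (Additive.ofMul a) + c (Additive.ofMul b) :=
          map_add c _ _
        rw [this, map_add, AddCircle.toCircle_add] }
  let α : PontryaginDual Γ := (⟨f, continuous_of_discreteTopology⟩ : Γ →ₜ* Circle)
  refine ⟨α, fun h => hc (hi _ (AddCircle.injective_toCircle one_ne_zero ?_))⟩
  rw [AddCircle.toCircle_zero]
  exact Subtype.ext h

variable [MeasurableSpace (PontryaginDual Γ)] [BorelSpace (PontryaginDual Γ)]
  (ν : Measure (PontryaginDual Γ))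

/-- Translating by a `β` with `β γ ≠ 1` multiplies the integral by `β γ`, yet Haar measure is
invariant. -/
theorem integral_dualCharMap_eq_zero [ν.IsHaarMeasure] {γ : Γ} (hγ : γ ≠ 1) :
    ∫ α, dualCharMap γ α ∂ν = 0 := by
  obtain ⟨β, hβ⟩ := exists_dualCharMap_ne_one hγ
  have h := integral_mul_left_eq_self (μ := ν) (dualCharMap γ) β
  have h1 : ∀ α, dualCharMap γ (β * α) = dualCharMap γ β * dualCharMap γ α := fun α => by
    have : (β * α) γ = β γ * α γ := rfl
    simp [this]
  simp_rw [h1] at h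
  rw [integral_const_mul] at h
  have h2 : (dualCharMap γ β - 1) * ∫ α, dualCharMap γ α ∂ν = 0 := by
    rw [sub_mul, h, one_mul, sub_self]
  exact (mul_eq_zero.1 h2).resolve_left (sub_ne_zero.2 hβ)

variable [Countable Γ]

instance : SecondCountableTopology (PontryaginDual Γ) :=
  (ContinuousMonoidHom.isInducing_toContinuousMap Γ Circle).secondCountableTopology

/-- An integrable function with vanishing Fourier coefficients vanishes. -/
theorem ae_eq_zero_of_integral_dualCharMap_mul {g : PontryaginDual Γ → ℂ} (hg : Integrable g ν)
    (h : ∀ γ, ∫ α, dualCharMap γ α * g α ∂ν = 0) : g =ᵐ[ν] 0 := by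
  have hint : ∀ f : C(PontryaginDual Γ, ℂ), Integrable (fun α => f α * g α) ν := fun f =>
    hg.bdd_mul (c := ‖f‖) f.continuous.aestronglyMeasurable
      (Filter.Eventually.of_forall f.norm_coe_le_norm)
  let L : C(PontryaginDual Γ, ℂ) →ₗ[ℂ] ℂ :=
    { toFun := fun f => ∫ α, f α * g α ∂ν
      map_add' := fun f f' => by
        rw [← integral_add (hint f) (hint f')]
        simp [add_mul]
      map_smul' := fun c f => by
        simp [mul_assoc, integral_const_mul] }
  have hLc : Continuous L := by
    refine AddMonoidHomClass.continuous_of_bound L (∫ α, ‖g α‖ ∂ν) fun f => ?_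
    rw [mul_comm, ← integral_const_mul]
    refine norm_integral_le_of_norm_le (hg.norm.const_mul _) (Filter.Eventually.of_forall fun α => ?_)
    rw [norm_mul]
    gcongr
    exact f.norm_coe_le_norm α
  have hL : ∀ f, L f = 0 := by
    have h1 : (Submodule.span ℂ (Set.range (dualCharMap (Γ := Γ)))) ≤ LinearMap.ker L := by
      rw [Submodule.span_le]
      rintro - ⟨γ, rfl⟩
      exact h γ
    have h2 : IsClosed (LinearMap.ker L : Set C(PontryaginDual Γ, ℂ)) :=
      isClosed_singleton.preimage hLc
    intro f
    have h3 : f ∈ (trigPolynomials Γ).topologicalClosure := by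
      rw [topologicalClosure_trigPolynomials]; trivial
    have h4 : (trigPolynomials Γ : Set C(PontryaginDual Γ, ℂ)) ⊆ LinearMap.ker L := by
      intro p hp
      refine h1 ?_
      rw [← trigPolynomials_toSubmodule]
      exact hp
    exact closure_minimal h4 h2 h3
  -- Stone–Weierstrass gave all continuous test functions; indicators of closed sets are their
  -- bounded pointwise limits.
  refine ae_eq_zero_of_forall_setIntegral_isClosed_eq_zero hg fun K hK => ?_
  have h1 : Filter.Tendsto (fun n => ∫ α, ((hK.apprSeq n α : ℝ≥0) : ℂ) * g α ∂ν) Filter.atTop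
      (nhds (∫ α, K.indicator g α ∂ν)) := by
    refine tendsto_integral_of_dominated_convergence (fun α => ‖g α‖) ?_ hg.norm ?_ ?_
    · intro n
      refine AEStronglyMeasurable.mul ?_ hg.1
      exact (by fun_prop : Continuous fun α =>
        ((hK.apprSeq n α : ℝ≥0) : ℂ)).aestronglyMeasurable
    · refine fun n => Filter.Eventually.of_forall fun α => ?_
      rw [norm_mul]
      refine mul_le_of_le_one_left (norm_nonneg _) ?_
      simpa using HasOuterApproxClosed.apprSeq_apply_le_one hK n α
    · refine Filter.Eventually.of_forall fun α => ?_
      have := tendsto_pi_nhds.1 (HasOuterApproxClosed.tendsto_apprSeq hK) α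
      have h3 : K.indicator g α = ((K.indicator (fun _ => (1 : ℝ≥0)) α : ℝ≥0) : ℂ) * g α := by
        by_cases hα : α ∈ K <;> simp [hα]
      rw [h3]
      refine Filter.Tendsto.mul_const _ ?_
      exact ((by fun_prop : Continuous fun x : ℝ≥0 => (x : ℂ)).tendsto _).comp this
  have h2 : ∀ n, ∫ α, ((hK.apprSeq n α : ℝ≥0) : ℂ) * g α ∂ν = 0 := fun n =>
    hL ⟨fun α => ((hK.apprSeq n α : ℝ≥0) : ℂ), by fun_prop⟩
  simp_rw [h2] at h1
  rw [← integral_indicator hK.measurableSet]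
  exact tendsto_nhds_unique h1 tendsto_const_nhds

/-- Parseval's identity on the dual group. -/
theorem hasSum_norm_sq_integral_dualCharMap_mul [ν.IsHaarMeasure] [IsProbabilityMeasure ν]
    {g : PontryaginDual Γ → ℂ} (hg : MemLp g 2 ν) :
    HasSum (fun γ : Γ => ‖∫ α, dualCharMap γ α * g α ∂ν‖ ^ 2) (∫ α, ‖g α‖ ^ 2 ∂ν) := by
  -- The inverse offsets the conjugation in the first slot of `inner`.
  have hX : ∀ γ : Γ, MemLp (dualCharMap γ⁻¹ : PontryaginDual Γ → ℂ) 2 ν := fun γ =>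
    MemLp.of_bound (dualCharMap γ⁻¹).continuous.aestronglyMeasurable 1
      (Filter.Eventually.of_forall fun α => (norm_dualCharMap _ α).le)
  let e : Γ → Lp ℂ 2 ν := fun γ => (hX γ).toLp _
  have hinner : ∀ γ {h : PontryaginDual Γ → ℂ} (F : Lp ℂ 2 ν), (F =ᵐ[ν] h) →
      inner ℂ (e γ) F = ∫ α, dualCharMap γ α * h α ∂ν := by
    intro γ h F hF
    rw [L2.inner_def]
    refine integral_congr_ae ?_
    filter_upwards [(hX γ).coeFn_toLp, hF] with α h1 h2
    rw [h1, h2, dualCharMap_inv, RCLike.inner_apply, starRingEnd_self_apply, mul_comm]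
  have he : Orthonormal ℂ e := by
    classical
    rw [orthonormal_iff_ite]
    intro γ γ'
    rw [hinner γ _ (hX γ').coeFn_toLp]
    simp_rw [← dualCharMap_mul]
    split_ifs with h
    · subst h
      simp
    · exact integral_dualCharMap_eq_zero ν (fun h' => h (mul_inv_eq_one.1 h'))
  have hbot : (Submodule.span ℂ (Set.range e))ᗮ = ⊥ := by
    rw [eq_bot_iff]
    intro F hF
    have hF1 : Integrable F ν := (Lp.memLp F).integrable one_le_two
    have hF2 := ae_eq_zero_of_integral_dualCharMap_mul ν hF1 fun γ => by
      rw [← hinner γ F (Filter.EventuallyEq.refl _ _)]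
      exact Submodule.inner_right_of_mem_orthogonal
        (Submodule.subset_span (Set.mem_range_self γ)) hF
    rw [Submodule.mem_bot]
    exact (Lp.eq_zero_iff_ae_eq_zero).2 hF2
  let b := HilbertBasis.mkOfOrthogonalEqBot he hbot
  have hb : ∀ γ, b γ = e γ := fun γ => by simp [b]
  have h1 := b.hasSum_inner_mul_inner (hg.toLp g) (hg.toLp g)
  have h2 : ∀ γ, inner ℂ (hg.toLp g) (b γ) * inner ℂ (b γ) (hg.toLp g) =
      ((‖∫ α, dualCharMap γ α * g α ∂ν‖ ^ 2 : ℝ) : ℂ) := fun γ => by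
    rw [hb, ← inner_conj_symm, hinner γ _ hg.coeFn_toLp, mul_comm, Complex.mul_conj,
      Complex.normSq_eq_norm_sq]
  have h3 : inner ℂ (hg.toLp g) (hg.toLp g) = ((∫ α, ‖g α‖ ^ 2 ∂ν : ℝ) : ℂ) := by
    rw [L2.inner_def, ← integral_complex_ofReal]
    refine integral_congr_ae ?_
    filter_upwards [hg.coeFn_toLp] with α hα
    rw [hα, inner_self_eq_norm_sq_to_K]
    simp
  simp_rw [h2, h3] at h1
  exact Complex.hasSum_ofReal.1 h1

end DualGroup

theorem ofReal_norm_sq_Lp {Y F : Type*} [MeasurableSpace Y] {ρ : Measure Y} [NormedAddCommGroup F]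
    (f : Lp F 2 ρ) : ENNReal.ofReal (‖f‖ ^ 2) = ∫⁻ y, ‖f y‖ₑ ^ 2 ∂ρ := by
  rw [Lp.norm_def, ← ENNReal.toReal_pow, ENNReal.ofReal_toReal
    (ENNReal.pow_ne_top (Lp.eLpNorm_ne_top f)),
    eLpNorm_eq_lintegral_rpow_enorm_toReal two_ne_zero ENNReal.ofNat_ne_top]
  simp only [ENNReal.toReal_ofNat, ENNReal.rpow_ofNat, one_div]
  rw [← ENNReal.rpow_ofNat, ← ENNReal.rpow_mul]
  simp

/-! ### Translation operators and the Jacobian cocycle -/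

section Translate

open scoped Pointwise

variable {Γ : Type*} [CommGroup Γ] {X : Type*} [MeasurableSpace X] [MulAction Γ X]
  [MeasurableConstSMul Γ X] {μ : Measure X} {J : Γ → X → ℝ≥0}

theorem IsJacobian.quasiMeasurePreserving (hJ : IsJacobian μ J) (γ : Γ) :
    Measure.QuasiMeasurePreserving (fun x : X => γ • x) μ μ := by
  refine ⟨measurable_const_smul γ, Measure.AbsolutelyContinuous.mk fun E hE h0 => ?_⟩
  rw [Measure.map_apply (measurable_const_smul γ) hE]
  have h1 : (fun x : X => γ • x) ⁻¹' E = (fun x => γ⁻¹ • x) '' E := by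
    ext x
    simp only [Set.mem_preimage, Set.mem_image]
    exact ⟨fun h => ⟨_, h, inv_smul_smul _ _⟩, by rintro ⟨y, hy, rfl⟩; simpa using hy⟩
  rw [h1, hJ.measure_image γ⁻¹ E hE]
  exact setLIntegral_measure_zero _ _ h0

theorem IsJacobian.lintegral_comp_smul (hJ : IsJacobian μ J) (γ : Γ) {g : X → ℝ≥0∞}
    (hg : AEMeasurable g μ) : ∫⁻ x, J γ x * g (γ • x) ∂μ = ∫⁻ x, g x ∂μ := by
  have hq := hJ.quasiMeasurePreserving γ
  conv_rhs => rw [← hJ.map_withDensity γ]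
  rw [lintegral_map' (by rwa [hJ.map_withDensity γ]) (measurable_const_smul γ).aemeasurable]
  exact (lintegral_withDensity_eq_lintegral_mul₀
    (hJ.measurable γ).coe_nnreal_ennreal.aemeasurable (hg.comp_quasiMeasurePreserving hq)).symm

/-- Both sides are densities of `E ↦ μ (γ γ' E)`; σ-finiteness makes densities a.e. unique. -/
theorem IsJacobian.jacobian_mul [SigmaFinite μ] (hJ : IsJacobian μ J) (γ γ' : Γ) :
    ∀ᵐ x ∂μ, J (γ * γ') x = J γ (γ' • x) * J γ' x := by
  have hm : Measurable fun x => (J γ (γ' • x) : ℝ≥0∞) * J γ' x :=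
    ((hJ.measurable γ).comp (measurable_const_smul γ')).coe_nnreal_ennreal.mul
      (hJ.measurable γ').coe_nnreal_ennreal
  have h := ae_eq_of_forall_setLIntegral_eq_of_sigmaFinite (μ := μ)
    (hJ.measurable (γ * γ')).coe_nnreal_ennreal hm fun E hE _ => by
      have hE' : MeasurableSet ((fun x : X => γ' • x) '' E) := by
        rw [show (fun x : X => γ' • x) '' E = (fun x => γ'⁻¹ • x) ⁻¹' E from
          Set.image_smul.trans (Set.preimage_smul_inv γ' E).symm]
        exact measurable_const_smul γ'⁻¹ hE
      have h1 : (fun x : X => (γ * γ') • x) '' E = (fun x => γ • x) '' ((fun x => γ' • x) '' E) := by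
        rw [Set.image_image]
        simp [mul_smul]
      rw [← hJ.measure_image _ E hE, h1, hJ.measure_image γ _ hE', ← lintegral_indicator hE',
        ← hJ.lintegral_comp_smul γ' ((hJ.measurable γ).coe_nnreal_ennreal.indicator hE').aemeasurable,
        ← lintegral_indicator hE]
      refine lintegral_congr fun x => ?_
      by_cases hx : x ∈ E
      · have hx' : γ' • x ∈ (fun x : X => γ' • x) '' E := ⟨x, hx, rfl⟩
        rw [Set.indicator_of_mem hx, Set.indicator_of_mem hx', mul_comm]
      · have hx' : γ' • x ∉ (fun x : X => γ' • x) '' E := by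
          rintro ⟨y, hy, hxy⟩
          exact hx (MulAction.injective γ' hxy ▸ hy)
        rw [Set.indicator_of_notMem hx, Set.indicator_of_notMem hx', mul_zero]
  filter_upwards [h] with x hx
  exact_mod_cast hx

theorem coeFn_translate (hJ : IsJacobian μ J) (γ : Γ) (f : Lp ℂ 2 μ) :
    translate hJ γ f =ᵐ[μ] fun x => ((Real.sqrt (J γ⁻¹ x) : ℝ) : ℂ) * f (γ⁻¹ • x) :=
  MemLp.coeFn_toLp _

theorem translate_add (hJ : IsJacobian μ J) (γ : Γ) (f g : Lp ℂ 2 μ) :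
    translate hJ γ (f + g) = translate hJ γ f + translate hJ γ g := by
  apply Lp.ext
  filter_upwards [coeFn_translate hJ γ (f + g), coeFn_translate hJ γ f, coeFn_translate hJ γ g,
    Lp.coeFn_add (translate hJ γ f) (translate hJ γ g),
    (hJ.quasiMeasurePreserving γ⁻¹).ae (Lp.coeFn_add f g)] with x h1 h2 h3 h4 h5
  rw [h1, h4, Pi.add_apply, h2, h3, h5, Pi.add_apply, mul_add]

theorem translate_smul (hJ : IsJacobian μ J) (γ : Γ) (c : ℂ) (f : Lp ℂ 2 μ) :
    translate hJ γ (c • f) = c • translate hJ γ f := by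
  apply Lp.ext
  filter_upwards [coeFn_translate hJ γ (c • f), coeFn_translate hJ γ f,
    Lp.coeFn_smul c (translate hJ γ f),
    (hJ.quasiMeasurePreserving γ⁻¹).ae (Lp.coeFn_smul c f)] with x h1 h2 h3 h4
  rw [h1, h3, Pi.smul_apply, h2, h4, Pi.smul_apply, smul_eq_mul, smul_eq_mul]
  ring

theorem translate_mul [SigmaFinite μ] (hJ : IsJacobian μ J) (γ γ' : Γ) (f : Lp ℂ 2 μ) :
    translate hJ γ (translate hJ γ' f) = translate hJ (γ * γ') f := by
  apply Lp.ext
  filter_upwards [coeFn_translate hJ γ (translate hJ γ' f), coeFn_translate hJ (γ * γ') f,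
    (hJ.quasiMeasurePreserving γ⁻¹).ae (coeFn_translate hJ γ' f),
    hJ.jacobian_mul γ'⁻¹ γ⁻¹] with x h1 h2 h3 h4
  rw [h1, h2, h3, mul_inv_rev, h4, NNReal.coe_mul, Real.sqrt_mul (NNReal.coe_nonneg _), mul_smul]
  push_cast
  ring

/-- The squared norms of the restrictions of the translates of `f` to a fundamental domain add up
to the squared norm of `f`. -/
theorem hasSum_norm_sq_restrict_translate [Countable Γ] (hJ : IsJacobian μ J) {C : Set X}
    (hC : IsFundamentalDomain Γ C μ) (f : Lp ℂ 2 μ) :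
    HasSum (fun γ : Γ => ‖LpToLpRestrictCLM X ℂ ℂ μ 2 C (translate hJ γ f)‖ ^ 2) (‖f‖ ^ 2) := by
  have hnull : ∀ γ : Γ, NullMeasurableSet (γ • C) μ := fun γ => by
    rw [← Set.preimage_smul_inv]
    exact hC.nullMeasurableSet.preimage (hJ.quasiMeasurePreserving γ⁻¹)
  have hfm : AEMeasurable (fun x => ‖f x‖ₑ ^ 2) μ :=
    (Lp.aestronglyMeasurable f).enorm.pow_const 2
  -- The Jacobian is the change of variables from `C` to `γ⁻¹ • C`; these sets tile `X`.
  have h1 : ∀ γ : Γ, ENNReal.ofReal (‖LpToLpRestrictCLM X ℂ ℂ μ 2 C (translate hJ γ f)‖ ^ 2) =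
      ∫⁻ x in γ⁻¹ • C, ‖f x‖ₑ ^ 2 ∂μ := by
    intro γ
    rw [ofReal_norm_sq_Lp, ← lintegral_indicator₀ (hnull γ⁻¹),
      ← hJ.lintegral_comp_smul γ⁻¹ (hfm.indicator₀ (hnull γ⁻¹))]
    have h2 : ∀ x, (J γ⁻¹ x : ℝ≥0∞) * (γ⁻¹ • C).indicator (fun x => ‖f x‖ₑ ^ 2) (γ⁻¹ • x) =
        C.indicator (fun x => (J γ⁻¹ x : ℝ≥0∞) * ‖f (γ⁻¹ • x)‖ₑ ^ 2) x := by
      intro x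
      by_cases hx : x ∈ C
      · rw [Set.indicator_of_mem hx, Set.indicator_of_mem (Set.smul_mem_smul_set hx)]
      · rw [Set.indicator_of_notMem hx,
          Set.indicator_of_notMem (by rwa [Set.smul_mem_smul_set_iff]), mul_zero]
    simp_rw [h2]
    rw [lintegral_indicator₀ hC.nullMeasurableSet]
    refine lintegral_congr_ae ?_
    filter_upwards [LpToLpRestrictCLM_coeFn ℂ C (translate hJ γ f),
      ae_restrict_of_ae (coeFn_translate hJ γ f)] with x h3 h4
    rw [h3, h4, enorm_mul, mul_pow]
    congr 1
    rw [← ofReal_norm, Complex.norm_real, Real.norm_of_nonneg (Real.sqrt_nonneg _),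
      ← ENNReal.ofReal_pow (Real.sqrt_nonneg _),
      Real.sq_sqrt (NNReal.coe_nonneg _), ENNReal.ofReal_coe_nnreal]
  have h2 : ∑' γ : Γ, ENNReal.ofReal (‖LpToLpRestrictCLM X ℂ ℂ μ 2 C (translate hJ γ f)‖ ^ 2) =
      ENNReal.ofReal (‖f‖ ^ 2) := by
    have h3 : ∑' γ : Γ, ∫⁻ x in γ⁻¹ • C, ‖f x‖ₑ ^ 2 ∂μ = ∑' γ : Γ, ∫⁻ x in γ • C, ‖f x‖ₑ ^ 2 ∂μ :=
      (Equiv.inv Γ).tsum_eq fun γ : Γ => ∫⁻ x in γ • C, ‖f x‖ₑ ^ 2 ∂μ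
    simp_rw [h1]
    rw [h3, ← lintegral_iUnion₀ hnull hC.aedisjoint, ofReal_norm_sq_Lp,
      setLIntegral_congr hC.iUnion_smul_ae_eq, Measure.restrict_univ]
  have h3 := ENNReal.hasSum_toReal (h2.trans_ne ENNReal.ofReal_ne_top)
  rw [← ENNReal.tsum_toReal_eq fun _ => ENNReal.ofReal_ne_top, h2] at h3
  simpa [ENNReal.toReal_ofReal] using h3

end Translate

/-! ### Multiplicatively invariant spaces and their fibers -/

section Multiplication

variable {Γ : Type*} [CommGroup Γ] [TopologicalSpace Γ]
  [MeasurableSpace (PontryaginDual Γ)] [BorelSpace (PontryaginDual Γ)]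
  {ν : Measure (PontryaginDual Γ)}
  {H : Type*} [NormedAddCommGroup H] [InnerProductSpace ℂ H]

theorem coeFn_dualChar_smul (γ : Γ) (F : Lp H 2 ν) :
    (dualChar ν γ • F : Lp H 2 ν) =ᵐ[ν] fun α => dualCharMap γ α • F α := by
  filter_upwards [Lp.coeFn_lpSMul (r := 2) (dualChar ν γ) F, (memLp_dualChar ν γ).coeFn_toLp]
    with α h1 h2
  rw [h1, Pi.smul_apply', dualChar, h2, dualCharMap_apply]

theorem norm_dualChar_smul (γ : Γ) (F : Lp H 2 ν) : ‖(dualChar ν γ • F : Lp H 2 ν)‖ = ‖F‖ := by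
  rw [Lp.norm_def, Lp.norm_def]
  congr 1
  refine eLpNorm_congr_norm_ae ?_
  filter_upwards [coeFn_dualChar_smul γ F] with α h
  rw [h, norm_smul, norm_dualCharMap, one_mul]

theorem inner_dualChar_smul_left (γ : Γ) (F G : Lp H 2 ν) :
    inner ℂ (dualChar ν γ • F : Lp H 2 ν) G = ∫ α, dualCharMap γ⁻¹ α * inner ℂ (F α) (G α) ∂ν := by
  rw [L2.inner_def]
  refine integral_congr_ae ?_
  filter_upwards [coeFn_dualChar_smul γ F] with α h
  rw [h, inner_smul_left, dualCharMap_inv]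

theorem dualChar_smul_dualChar_smul (γ γ' : Γ) (F : Lp H 2 ν) :
    (dualChar ν γ • (dualChar ν γ' • F : Lp H 2 ν) : Lp H 2 ν) = dualChar ν (γ * γ') • F := by
  apply Lp.ext
  filter_upwards [coeFn_dualChar_smul γ (dualChar ν γ' • F : Lp H 2 ν), coeFn_dualChar_smul γ' F,
    coeFn_dualChar_smul (γ * γ') F] with α h1 h2 h3
  rw [h1, h2, h3, dualCharMap_mul, mul_smul]

/-- Multiplication by the character `α ↦ α γ` on `L²`. -/
def dualCharMul (ν : Measure (PontryaginDual Γ)) (H : Type*) [NormedAddCommGroup H]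
    [InnerProductSpace ℂ H] (γ : Γ) : Lp H 2 ν →ₗᵢ[ℂ] Lp H 2 ν where
  toFun F := dualChar ν γ • F
  map_add' := Lp.add_smul _
  map_smul' c F := by
    apply Lp.ext
    filter_upwards [coeFn_dualChar_smul γ (c • F), coeFn_dualChar_smul γ F, Lp.coeFn_smul c F,
      Lp.coeFn_smul c (dualChar ν γ • F : Lp H 2 ν)] with α h1 h2 h3 h4
    rw [h1, h3, RingHom.id_apply, h4, Pi.smul_apply, Pi.smul_apply, h2, smul_comm]
  norm_map' := norm_dualChar_smul γ

/-- A function in the multiplicatively invariant space generated by `Φ` takes its values in the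
spans of the values of `Φ`. -/
theorem ae_mem_span_of_mem_miSpan {ι : Type*} [Finite ι] (Φ : ι → Lp H 2 ν) {F : Lp H 2 ν}
    (hF : F ∈ miSpan (Set.range (dualChar (Γ := Γ) ν)) Φ) :
    ∀ᵐ α ∂ν, F α ∈ Submodule.span ℂ (Set.range fun i => Φ i α) := by
  have h1 : ∀ G ∈ Submodule.span ℂ
      {F : Lp H 2 ν | ∃ g ∈ Set.range (dualChar (Γ := Γ) ν), ∃ i, F = g • Φ i},
      ∀ᵐ α ∂ν, G α ∈ Submodule.span ℂ (Set.range fun i => Φ i α) := by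
    intro G hG
    induction hG using Submodule.span_induction with
    | mem _ h =>
      obtain ⟨_, ⟨γ, rfl⟩, i, rfl⟩ := h
      filter_upwards [coeFn_dualChar_smul γ (Φ i)] with α h1
      rw [h1]
      exact Submodule.smul_mem _ _ (Submodule.subset_span ⟨i, rfl⟩)
    | zero =>
      filter_upwards [Lp.coeFn_zero H 2 ν] with α h1
      rw [h1]
      exact Submodule.zero_mem _
    | add a b _ _ ha hb =>
      filter_upwards [Lp.coeFn_add a b, ha, hb] with α h1 h2 h3
      rw [h1]
      exact Submodule.add_mem _ h2 h3
    | smul c a _ ha =>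
      filter_upwards [Lp.coeFn_smul c a, ha] with α h1 h2
      rw [h1]
      exact Submodule.smul_mem _ _ h2
  -- An `L²` limit is an a.e. limit along a subsequence, and finite-dimensional fiber spans are
  -- closed.
  obtain ⟨u, hu, hlim⟩ := mem_closure_iff_seq_limit.1 hF
  obtain ⟨ns, -, hns⟩ := (tendstoInMeasure_of_tendsto_Lp hlim).exists_seq_tendsto_ae
  filter_upwards [hns, ae_all_iff.2 fun n => h1 (u n) (hu n)] with α h2 h3
  have : FiniteDimensional ℂ (Submodule.span ℂ (Set.range fun i => Φ i α)) :=
    FiniteDimensional.span_of_finite ℂ (Set.finite_range _)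
  exact (Submodule.closed_of_finiteDimensional _).mem_of_tendsto h2
    (Filter.Eventually.of_forall fun n => h3 (ns n))

/-- For the converse, take `G` orthogonal to the space: every `α ↦ ⟪Φ i α, G α⟫` has vanishing
Fourier coefficients, so `G α ⊥ Φ i α` a.e., hence `F ⊥ G`. The double orthogonal complement is the
closed span. -/
theorem mem_miSpan_iff [DiscreteTopology Γ] [Countable Γ] [CompleteSpace H] {ι : Type*} [Finite ι]
    (Φ : ι → Lp H 2 ν) (F : Lp H 2 ν) :
    F ∈ miSpan (Set.range (dualChar (Γ := Γ) ν)) Φ ↔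
      ∀ᵐ α ∂ν, F α ∈ Submodule.span ℂ (Set.range fun i => Φ i α) := by
  refine ⟨ae_mem_span_of_mem_miSpan Φ, fun h => ?_⟩
  rw [miSpan, ← Submodule.orthogonal_orthogonal_eq_closure, Submodule.mem_orthogonal']
  intro G hG
  have h1 : ∀ i, ∀ᵐ α ∂ν, inner ℂ (Φ i α) (G α) = 0 := by
    intro i
    refine ae_eq_zero_of_integral_dualCharMap_mul ν (L2.integrable_inner (Φ i) G) fun γ => ?_
    have hmem : (dualChar ν γ⁻¹ • Φ i : Lp H 2 ν) ∈ Submodule.span ℂ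
        {F : Lp H 2 ν | ∃ g ∈ Set.range (dualChar (Γ := Γ) ν), ∃ i, F = g • Φ i} :=
      Submodule.subset_span ⟨_, ⟨γ⁻¹, rfl⟩, i, rfl⟩
    have := Submodule.inner_right_of_mem_orthogonal hmem hG
    rwa [inner_dualChar_smul_left, inv_inv] at this
  rw [L2.inner_def]
  refine integral_eq_zero_of_ae ?_
  filter_upwards [h, ae_all_iff.2 h1] with α h2 h3
  have h4 : Submodule.span ℂ (Set.range fun i => Φ i α) ≤ (Submodule.span ℂ {G α})ᗮ := by
    rw [Submodule.span_le]
    rintro - ⟨i, rfl⟩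
    exact Submodule.mem_orthogonal_singleton_iff_inner_left.2 (h3 i)
  exact Submodule.mem_orthogonal_singleton_iff_inner_left.1 (h4 h2)

end Multiplication

/-! ### The fiberization isometry -/

section Fiberization

variable {Γ : Type*} [CommGroup Γ] [TopologicalSpace Γ] [DiscreteTopology Γ] [Countable Γ]
  [MeasurableSpace (PontryaginDual Γ)] [BorelSpace (PontryaginDual Γ)]
  (ν : Measure (PontryaginDual Γ)) [ν.IsHaarMeasure] [IsProbabilityMeasure ν]

/-- The isometry `h ↦ X_{γ⁻¹} ⊗ h`. -/
def dualCharConst (H : Type*) [NormedAddCommGroup H] [InnerProductSpace ℂ H] (γ : Γ) :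
    H →ₗᵢ[ℂ] Lp H 2 ν :=
  (dualCharMul ν H γ⁻¹).comp
    { Lp.constₗ 2 ν ℂ with
      norm_map' := fun h => by
        change ‖Lp.const 2 ν h‖ = ‖h‖
        simp [Lp.norm_const'] }

omit [Countable Γ] in
theorem orthogonalFamily_dualCharConst (H : Type*) [NormedAddCommGroup H]
    [InnerProductSpace ℂ H] [CompleteSpace H] :
    OrthogonalFamily ℂ (fun _ : Γ => H) (dualCharConst ν H) := by
  intro γ γ' hγ h h'
  change inner ℂ (dualChar ν γ⁻¹ • Lp.const 2 ν h : Lp H 2 ν)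
    (dualChar ν γ'⁻¹ • Lp.const 2 ν h' : Lp H 2 ν) = 0
  rw [inner_dualChar_smul_left, inv_inv]
  have h1 : ∀ᵐ α ∂ν, dualCharMap γ α * inner ℂ ((Lp.const 2 ν h : Lp H 2 ν) α)
      ((dualChar ν γ'⁻¹ • Lp.const 2 ν h' : Lp H 2 ν) α) =
      dualCharMap (γ * γ'⁻¹) α * inner ℂ h h' := by
    filter_upwards [Lp.coeFn_const (p := 2) (μ := ν) h, Lp.coeFn_const (p := 2) (μ := ν) h',
      coeFn_dualChar_smul γ'⁻¹ (Lp.const 2 ν h' : Lp H 2 ν)] with α h1 h2 h3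
    rw [h3, h1, h2, Function.const_apply, Function.const_apply, inner_smul_right, dualCharMap_mul,
      mul_assoc]
  rw [integral_congr_ae h1, integral_mul_const, integral_dualCharMap_eq_zero, zero_mul]
  exact fun h => hγ (mul_inv_eq_one.1 h)

variable {X : Type*} [MeasurableSpace X] [MulAction Γ X]
  [MeasurableConstSMul Γ X] {μ : Measure X} {J : Γ → X → ℝ≥0} (hJ : IsJacobian μ J) {C : Set X}
  (hC : IsFundamentalDomain Γ C μ)

include hC

/-- Orthogonality and square-summability give genuine convergence, so the `tsum` is not its default
value. -/
theorem hasSum_fiberMap (f : Lp ℂ 2 μ) :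
    HasSum (fun γ : Γ => dualCharConst ν (Lp ℂ 2 (μ.restrict C)) γ
      (LpToLpRestrictCLM X ℂ ℂ μ 2 C (translate hJ γ f))) (fiberMap ν hJ C f) :=
  (((orthogonalFamily_dualCharConst ν _).summable_iff_norm_sq_summable _).2
    (hasSum_norm_sq_restrict_translate hJ hC f).summable).hasSum

theorem norm_fiberMap (f : Lp ℂ 2 μ) : ‖fiberMap ν hJ C f‖ = ‖f‖ := by
  have hs := hasSum_norm_sq_restrict_translate hJ hC f
  have hmem : Memℓp (fun γ : Γ => LpToLpRestrictCLM X ℂ ℂ μ 2 C (translate hJ γ f)) 2 :=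
    memℓp_gen (by simpa using hs.summable)
  have h1 := (orthogonalFamily_dualCharConst ν (Lp ℂ 2 (μ.restrict C))).linearIsometry_apply
    ⟨_, hmem⟩
  have h2 : fiberMap ν hJ C f = _ := h1.symm
  rw [h2, LinearIsometry.norm_map, ← sq_eq_sq₀ (norm_nonneg _) (norm_nonneg _), ← hs.tsum_eq]
  have h3 := lp.norm_rpow_eq_tsum (p := 2) (by norm_num)
    (⟨_, hmem⟩ : lp (fun _ : Γ => Lp ℂ 2 (μ.restrict C)) 2)
  simpa using h3

/-- The fiberization map as a linear isometry. -/
def fiberIsometry : Lp ℂ 2 μ →ₗᵢ[ℂ] Lp (Lp ℂ 2 (μ.restrict C)) 2 ν where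
  toFun := fiberMap ν hJ C
  map_add' f g := by
    refine (hasSum_fiberMap ν hJ hC (f + g)).unique ?_
    convert (hasSum_fiberMap ν hJ hC f).add (hasSum_fiberMap ν hJ hC g) using 2 with γ
    rw [translate_add, map_add, map_add]
  map_smul' c f := by
    rw [RingHom.id_apply]
    refine (hasSum_fiberMap ν hJ hC (c • f)).unique ?_
    convert (hasSum_fiberMap ν hJ hC f).const_smul c using 2 with γ
    rw [translate_smul, map_smul, map_smul]
  norm_map' := norm_fiberMap ν hJ hC

omit hC in
theorem fiberIsometry_apply (hC : IsFundamentalDomain Γ C μ) (f : Lp ℂ 2 μ) :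
    fiberIsometry ν hJ hC f = fiberMap ν hJ C f := rfl

/-- Reindexing the series by `γ' ↦ γ' * γ` pulls out the character. -/
theorem fiberMap_translate [SigmaFinite μ] (γ : Γ) (f : Lp ℂ 2 μ) :
    fiberMap ν hJ C (translate hJ γ f) = dualChar ν γ • fiberMap ν hJ C f := by
  refine (hasSum_fiberMap ν hJ hC (translate hJ γ f)).unique ?_
  have h1 := (hasSum_fiberMap ν hJ hC f).mapL
    (dualCharMul ν (Lp ℂ 2 (μ.restrict C)) γ).toContinuousLinearMap
  rw [← (Equiv.mulRight γ).hasSum_iff] at h1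
  change HasSum _ ((dualCharMul ν _ γ).toContinuousLinearMap (fiberMap ν hJ C f))
  convert h1 using 2 with γ'
  simp only [Function.comp_apply, Equiv.coe_mulRight]
  rw [translate_mul]
  set h := LpToLpRestrictCLM X ℂ ℂ μ 2 C (translate hJ (γ' * γ) f)
  change (dualChar ν γ'⁻¹ • Lp.const 2 ν h : Lp (Lp ℂ 2 (μ.restrict C)) 2 ν) =
    (dualChar ν γ • (dualChar ν (γ' * γ)⁻¹ • Lp.const 2 ν h : Lp (Lp ℂ 2 (μ.restrict C)) 2 ν) :
      Lp (Lp ℂ 2 (μ.restrict C)) 2 ν)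
  rw [dualChar_smul_dualChar_smul, mul_inv_rev, mul_inv_cancel_left]

theorem fiberMap_image_invariantSpan [SigmaFinite μ] {m : ℕ} (φ : Fin m → Lp ℂ 2 μ) :
    fiberMap ν hJ C '' (invariantSpan hJ φ : Set (Lp ℂ 2 μ)) =
      miSpan (Set.range (dualChar (Γ := Γ) ν)) fun j => fiberMap ν hJ C (φ j) := by
  set T := fiberIsometry ν hJ hC
  change T '' (closure (Submodule.span ℂ (Set.range (system hJ φ)) : Set (Lp ℂ 2 μ))) = closure _
  rw [← T.isometry.isClosedEmbedding.closure_image_eq]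
  congr 1
  have h1 : (T '' (Submodule.span ℂ (Set.range (system hJ φ)) : Set (Lp ℂ 2 μ))) =
      ((Submodule.span ℂ (Set.range (system hJ φ))).map T.toLinearMap : Set _) := rfl
  rw [h1, Submodule.map_span]
  congr 2
  ext F
  constructor
  · rintro ⟨-, ⟨⟨γ, j⟩, rfl⟩, rfl⟩
    exact ⟨_, ⟨γ, rfl⟩, j, fiberMap_translate ν hJ hC γ (φ j)⟩
  · rintro ⟨-, ⟨γ, rfl⟩, j, rfl⟩
    exact ⟨_, ⟨(γ, j), rfl⟩, fiberMap_translate ν hJ hC γ (φ j)⟩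

theorem mem_invariantSpan_iff [SigmaFinite μ] {m : ℕ} (φ : Fin m → Lp ℂ 2 μ) (f : Lp ℂ 2 μ) :
    f ∈ invariantSpan hJ φ ↔ ∀ᵐ α ∂ν, fiberMap ν hJ C f α ∈
      Submodule.span ℂ (Set.range fun j => fiberMap ν hJ C (φ j) α) := by
  rw [← mem_miSpan_iff, ← SetLike.mem_coe, ← SetLike.mem_coe,
    ← fiberMap_image_invariantSpan ν hJ hC φ]
  exact ((fiberIsometry ν hJ hC).injective.mem_set_image).symm

end Fiberization

/-! ### Fiberwise form of generation and of frame sums -/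

section Fibers

theorem system_mem_invariantSpan {Γ : Type*} [CommGroup Γ] {X : Type*} [MeasurableSpace X]
    [MulAction Γ X] [MeasurableConstSMul Γ X] {μ : Measure X} {J : Γ → X → ℝ≥0}
    (hJ : IsJacobian μ J) {m : ℕ} (φ : Fin m → Lp ℂ 2 μ) (p : Γ × Fin m) :
    system hJ φ p ∈ invariantSpan hJ φ :=
  subset_closure (Submodule.subset_span (Set.mem_range_self p))

variable {Γ : Type*} [CommGroup Γ] [TopologicalSpace Γ] [DiscreteTopology Γ] [Countable Γ]
  [MeasurableSpace (PontryaginDual Γ)] [BorelSpace (PontryaginDual Γ)]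
  (ν : Measure (PontryaginDual Γ)) [ν.IsHaarMeasure] [IsProbabilityMeasure ν]
  {X : Type*} [MeasurableSpace X] [MulAction Γ X]
  [MeasurableConstSMul Γ X] {μ : Measure X} [SigmaFinite μ] {J : Γ → X → ℝ≥0}
  (hJ : IsJacobian μ J) {C : Set X} (hC : IsFundamentalDomain Γ C μ) {m l k : ℕ}

/-- The values at `α` of the fiberizations of a finite family. -/
def fibers (C : Set X) (φ : Fin m → Lp ℂ 2 μ) (α : PontryaginDual Γ) :
    Fin m → Lp ℂ 2 (μ.restrict C) :=
  fun j => fiberMap ν hJ C (φ j) α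

include hC

omit [SigmaFinite μ] in
theorem ae_fiberMap_sum (φ : Fin m → Lp ℂ 2 μ) (c : Fin m → ℂ) :
    ∀ᵐ α ∂ν, fiberMap ν hJ C (∑ j, c j • φ j) α = ∑ j, c j • fibers ν hJ C φ α j := by
  have h1 : fiberMap ν hJ C (∑ j, c j • φ j) = ∑ j, c j • fiberMap ν hJ C (φ j) := by
    simp only [← fiberIsometry_apply ν hJ hC, map_sum, map_smul]
  rw [h1]
  filter_upwards [Lp.coeFn_finsetSum Finset.univ fun j => c j • fiberMap ν hJ C (φ j),
    ae_all_iff.2 fun j => Lp.coeFn_smul (c j) (fiberMap ν hJ C (φ j))] with α h2 h3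
  rw [h2, Finset.sum_apply]
  exact Finset.sum_congr rfl fun j _ => h3 j

omit [SigmaFinite μ] in
theorem ae_fibers_linComb (φ : Fin m → Lp ℂ 2 μ) (A : Matrix (Fin l) (Fin m) ℂ) :
    ∀ᵐ α ∂ν, fibers ν hJ C (linComb A φ) α = linComb A (fibers ν hJ C φ α) := by
  filter_upwards [ae_all_iff.2 fun i => ae_fiberMap_sum ν hJ hC φ (A i)] with α h
  ext1 i
  exact h i

theorem mem_invariantSpan_iff_fibers (φ : Fin m → Lp ℂ 2 μ) (f : Lp ℂ 2 μ) :
    f ∈ invariantSpan hJ φ ↔ ∀ᵐ α ∂ν, fiberMap ν hJ C f α ∈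
      Submodule.span ℂ (Set.range (fibers ν hJ C φ α)) :=
  mem_invariantSpan_iff ν hJ hC φ f

include ν in
theorem mem_invariantSpan_self (φ : Fin m → Lp ℂ 2 μ) (j : Fin m) : φ j ∈ invariantSpan hJ φ :=
  (mem_invariantSpan_iff_fibers ν hJ hC φ _).2
    (Filter.Eventually.of_forall fun _ => Submodule.subset_span ⟨j, rfl⟩)

theorem mem_generatingMatrices_iff (φ : Fin m → Lp ℂ 2 μ) (A : Matrix (Fin l) (Fin m) ℂ) :
    A ∈ generatingMatrices hJ l φ ↔ ∀ᵐ α ∂ν, LinearMap.ker (Matrix.toEuclideanLin A) ⊓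
      LinearMap.range (Matrix.toEuclideanLin (gramian (fibers ν hJ C φ α))) = ⊥ := by
  simp_rw [ker_inf_range_gramian_eq_bot_iff]
  constructor
  · intro (h : invariantSpan hJ (linComb A φ) = invariantSpan hJ φ)
    have h1 : ∀ j, ∀ᵐ α ∂ν, fibers ν hJ C φ α j ∈
        Submodule.span ℂ (Set.range (fibers ν hJ C (linComb A φ) α)) := fun j =>
      (mem_invariantSpan_iff_fibers ν hJ hC _ _).1 (h ▸ mem_invariantSpan_self ν hJ hC φ j)
    filter_upwards [ae_all_iff.2 h1, ae_fibers_linComb ν hJ hC φ A] with α h2 h3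
    rw [h3] at h2
    exact le_antisymm (span_linComb_le A _) (Submodule.span_le.2 (Set.range_subset_iff.2 h2))
  · intro h
    refine SetLike.ext fun f => ?_
    rw [mem_invariantSpan_iff_fibers ν hJ hC, mem_invariantSpan_iff_fibers ν hJ hC]
    refine Filter.eventually_congr ?_
    filter_upwards [h, ae_fibers_linComb ν hJ hC φ A] with α h2 h3
    rw [h3, h2]

theorem ae_rank_gramian_fibers_le (φ : Fin m → Lp ℂ 2 μ)
    (hl : miLength (Set.range (dualChar (Γ := Γ) ν))
      (fiberMap ν hJ C '' (invariantSpan hJ φ : Set (Lp ℂ 2 μ))) ≤ (l : ℕ∞)) :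
    ∀ᵐ α ∂ν, (gramian (fibers ν hJ C φ α)).rank ≤ l := by
  set S := {k : ℕ∞ | ∃ n : ℕ, k = n ∧ ∃ Φ : Fin n → Lp (Lp ℂ 2 (μ.restrict C)) 2 ν,
    (∀ i, Φ i ∈ fiberMap ν hJ C '' (invariantSpan hJ φ : Set (Lp ℂ 2 μ))) ∧
    fiberMap ν hJ C '' (invariantSpan hJ φ : Set (Lp ℂ 2 μ)) =
      miSpan (Set.range (dualChar (Γ := Γ) ν)) Φ}
  -- An empty set would have infimum `⊤` in `ℕ∞`, contradicting `hl`; so the length is attained by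
  -- actual generators.
  have hne : S.Nonempty := by
    by_contra h
    rw [Set.not_nonempty_iff_eq_empty] at h
    change sInf S ≤ _ at hl
    rw [h, sInf_empty] at hl
    simp at hl
  have hmem : sInf S ∈ S := csInf_mem hne
  obtain ⟨n, hn, Φ, -, hΦ⟩ := hmem
  have hnl : n ≤ l := by
    change sInf S ≤ _ at hl
    rw [hn] at hl
    exact_mod_cast hl
  have h1 : ∀ j, ∀ᵐ α ∂ν, fibers ν hJ C φ α j ∈ Submodule.span ℂ (Set.range fun i => Φ i α) := by
    intro j
    refine ae_mem_span_of_mem_miSpan Φ ?_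
    rw [← SetLike.mem_coe, ← hΦ]
    exact ⟨_, mem_invariantSpan_self ν hJ hC φ j, rfl⟩
  filter_upwards [ae_all_iff.2 h1] with α h2
  exact (rank_gramian_le _ _ h2).trans hnl

omit [DiscreteTopology Γ] [Countable Γ] [ν.IsHaarMeasure] [SigmaFinite μ] hC in
theorem stronglyMeasurable_fibers (φ : Fin m → Lp ℂ 2 μ) (j : Fin m) :
    StronglyMeasurable fun α => fibers ν hJ C φ α j :=
  Lp.stronglyMeasurable _

theorem ae_mem_generatingMatrices (φ : Fin m → Lp ℂ 2 μ)
    (hl : miLength (Set.range (dualChar (Γ := Γ) ν))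
      (fiberMap ν hJ C '' (invariantSpan hJ φ : Set (Lp ℂ 2 μ))) ≤ (l : ℕ∞)) :
    ∀ᵐ A : Fin l → Fin m → ℂ, Matrix.of A ∈ generatingMatrices hJ l φ := by
  have hm : ∀ i j, Measurable fun α => gramian (fibers ν hJ C φ α) i j := fun i j =>
    ((stronglyMeasurable_fibers ν hJ φ j).inner (stronglyMeasurable_fibers ν hJ φ i)).measurable
  filter_upwards [ae_ae_rank_le_rank_mul ν hm (ae_rank_gramian_fibers_le ν hJ hC φ hl)] with A hA
  rw [mem_generatingMatrices_iff ν hJ hC]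
  filter_upwards [hA] with α hα
  exact (ker_inf_range_eq_bot_iff_rank _ _).2 hα

/-- The frame sums of a system of translates are integrals of fiberwise frame sums. -/
theorem hasSum_norm_sq_inner_system (ψ : Fin k → Lp ℂ 2 μ) (f : Lp ℂ 2 μ)
    (h : ∀ i, MemLp (fun α => (inner ℂ (fibers ν hJ C ψ α i) (fiberMap ν hJ C f α) : ℂ)) 2 ν) :
    HasSum (fun p => ‖inner ℂ (system hJ ψ p) f‖ ^ 2)
      (∫ α, ‖coeffs (fibers ν hJ C ψ α) (fiberMap ν hJ C f α)‖ ^ 2 ∂ν) := by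
  have h1 : ∀ i, HasSum (fun γ => ‖inner ℂ (system hJ ψ (γ, i)) f‖ ^ 2)
      (∫ α, ‖(inner ℂ (fibers ν hJ C ψ α i) (fiberMap ν hJ C f α) : ℂ)‖ ^ 2 ∂ν) := by
    intro i
    -- Pairing with `X_γ Φ` conjugates `X_γ`, so Parseval's coefficients appear at `γ⁻¹`.
    rw [← (Equiv.inv Γ).hasSum_iff]
    refine (hasSum_norm_sq_integral_dualCharMap_mul ν (h i)).congr_fun ?_
    intro γ
    rw [Function.comp_apply, Equiv.inv_apply, ← (fiberIsometry ν hJ hC).inner_map_map,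
      fiberIsometry_apply, fiberIsometry_apply, system, fiberMap_translate ν hJ hC,
      inner_dualChar_smul_left, inv_inv]
    rfl
  have h2 : ∫ α, ‖coeffs (fibers ν hJ C ψ α) (fiberMap ν hJ C f α)‖ ^ 2 ∂ν =
      ∑ i, ∫ α, ‖(inner ℂ (fibers ν hJ C ψ α i) (fiberMap ν hJ C f α) : ℂ)‖ ^ 2 ∂ν := by
    simp_rw [norm_sq_coeffs]
    exact integral_finsetSum _ fun i _ => (memLp_two_iff_integrable_sq_norm (h i).1).1 (h i)
  rw [h2, ← (Equiv.prodComm (Fin k) Γ).hasSum_iff]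
  have hs : Summable ((fun p => ‖inner ℂ (system hJ ψ p) f‖ ^ 2) ∘ Equiv.prodComm (Fin k) Γ) := by
    rw [summable_prod_of_nonneg fun _ => by simp only [Function.comp_apply]; positivity]
    exact ⟨fun i => (h1 i).summable, Summable.of_finite⟩
  have h3 := hs.hasSum.prod_fiberwise h1
  rw [← h3.unique (hasSum_fintype _)]
  exact hs.hasSum

end Fibers

/-! ### Frame bounds, globally and on fibers -/

section FrameBounds

variable {Γ : Type*} [CommGroup Γ] [TopologicalSpace Γ] [DiscreteTopology Γ] [Countable Γ]
  [MeasurableSpace (PontryaginDual Γ)] [BorelSpace (PontryaginDual Γ)]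
  (ν : Measure (PontryaginDual Γ)) [ν.IsHaarMeasure] [IsProbabilityMeasure ν]
  {X : Type*} [MeasurableSpace X] [MulAction Γ X]
  [MeasurableConstSMul Γ X] {μ : Measure X} [SigmaFinite μ] {J : Γ → X → ℝ≥0}
  (hJ : IsJacobian μ J) {C : Set X} (hC : IsFundamentalDomain Γ C μ) {m l k : ℕ}

theorem continuous_coeffs {E : Type*} [NormedAddCommGroup E] [InnerProductSpace ℂ E]
    (x : Fin m → E) : Continuous (coeffs x) :=
  (PiLp.continuous_toLp 2 _).comp (by fun_prop)

theorem integral_norm_sq_Lp {Y F : Type*} [MeasurableSpace Y] {ρ : Measure Y}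
    [NormedAddCommGroup F] [InnerProductSpace ℂ F] (f : Lp F 2 ρ) :
    ∫ y, ‖f y‖ ^ 2 ∂ρ = ‖f‖ ^ 2 := by
  have h := L2.inner_def (𝕜 := ℂ) f f
  simp_rw [inner_self_eq_norm_sq_to_K] at h
  have h2 : ∫ y, ((‖f y‖ : ℂ)) ^ 2 ∂ρ = ((∫ y, ‖f y‖ ^ 2 ∂ρ : ℝ) : ℂ) := by
    rw [← integral_complex_ofReal]
    simp
  have h3 := (h.trans h2).symm
  rw [← RCLike.ofReal_pow] at h3
  exact RCLike.ofReal_injective (K := ℂ) h3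

omit [DiscreteTopology Γ] [Countable Γ] [ν.IsHaarMeasure] [SigmaFinite μ] in
theorem measurable_norm_sq_coeffs_fibers (ψ : Fin k → Lp ℂ 2 μ) (f : Lp ℂ 2 μ) :
    Measurable fun α => ‖coeffs (fibers ν hJ C ψ α) (fiberMap ν hJ C f α)‖ ^ 2 := by
  simp_rw [norm_sq_coeffs]
  refine Finset.measurable_sum _ fun i _ => ?_
  exact (((stronglyMeasurable_fibers ν hJ ψ i).inner
    (Lp.stronglyMeasurable (fiberMap ν hJ C f))).norm.measurable).pow_const 2

include hC

/-- The function in `V` whose fiberization is the restriction of that of `f` to a measurable set. -/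
theorem exists_fiberMap_eq_indicator (φ : Fin m → Lp ℂ 2 μ) {f : Lp ℂ 2 μ}
    (hf : f ∈ invariantSpan hJ φ) {S : Set (PontryaginDual Γ)} (hS : MeasurableSet S) :
    ∃ g ∈ invariantSpan hJ φ, fiberMap ν hJ C g =ᵐ[ν] S.indicator (fiberMap ν hJ C f) := by
  have hm : MemLp (S.indicator (fiberMap ν hJ C f)) 2 ν := (Lp.memLp _).indicator hS
  -- Truncation preserves the fiberwise condition describing the image of `V`, so surjectivity of
  -- `fiberMap` onto the whole `L²` space is not needed.
  have h1 : hm.toLp _ ∈ fiberMap ν hJ C '' (invariantSpan hJ φ : Set (Lp ℂ 2 μ)) := by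
    rw [fiberMap_image_invariantSpan ν hJ hC, SetLike.mem_coe, mem_miSpan_iff]
    filter_upwards [(mem_invariantSpan_iff ν hJ hC φ f).1 hf, hm.coeFn_toLp] with α h1 h2
    rw [h2]
    by_cases hα : α ∈ S
    · rwa [Set.indicator_of_mem hα]
    · rw [Set.indicator_of_notMem hα]
      exact Submodule.zero_mem _
  obtain ⟨g, hg, hg'⟩ := h1
  exact ⟨g, hg, hg' ▸ hm.coeFn_toLp⟩

/-- Frame bounds on `V` hold fiberwise. -/
theorem ae_frame_bounds (φ : Fin m → Lp ℂ 2 μ) (ψ : Fin k → Lp ℂ 2 μ) {a b : ℝ}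
    (h : ∀ v ∈ invariantSpan hJ φ, a * ‖v‖ ^ 2 ≤ ∑' p, ‖inner ℂ (system hJ ψ p) v‖ ^ 2 ∧
      ∑' p, ‖inner ℂ (system hJ ψ p) v‖ ^ 2 ≤ b * ‖v‖ ^ 2)
    {f : Lp ℂ 2 μ} (hf : f ∈ invariantSpan hJ φ) :
    ∀ᵐ α ∂ν, a * ‖fiberMap ν hJ C f α‖ ^ 2 ≤
        ‖coeffs (fibers ν hJ C ψ α) (fiberMap ν hJ C f α)‖ ^ 2 ∧
      ‖coeffs (fibers ν hJ C ψ α) (fiberMap ν hJ C f α)‖ ^ 2 ≤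
        b * ‖fiberMap ν hJ C f α‖ ^ 2 := by
  set F := fiberMap ν hJ C f
  set q : PontryaginDual Γ → ℝ := fun α => ‖coeffs (fibers ν hJ C ψ α) (F α)‖ ^ 2
  have hqm : Measurable q := measurable_norm_sq_coeffs_fibers ν hJ ψ f
  have hFm : Measurable fun α => ‖F α‖ := (Lp.stronglyMeasurable F).norm.measurable
  have hψm : ∀ i, Measurable fun α => ‖fibers ν hJ C ψ α i‖ := fun i =>
    (stronglyMeasurable_fibers ν hJ ψ i).norm.measurable
  -- Fiberwise inner products are a priori only integrable; on `N R` they are bounded, so Parseval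
  -- applies to truncations. The `N R` exhaust the dual group.
  let N : ℕ → Set (PontryaginDual Γ) := fun R =>
    {α | ‖F α‖ ≤ R} ∩ ⋂ i, {α | ‖fibers ν hJ C ψ α i‖ ≤ R}
  have hN : ∀ R, MeasurableSet (N R) := fun R =>
    (measurableSet_le hFm measurable_const).inter
      (MeasurableSet.iInter fun i => measurableSet_le (hψm i) measurable_const)
  have hbound : ∀ R : ℕ, ∀ S, MeasurableSet S → S ⊆ N R → IntegrableOn q S ν ∧
      a * ∫ α in S, ‖F α‖ ^ 2 ∂ν ≤ ∫ α in S, q α ∂ν ∧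
      ∫ α in S, q α ∂ν ≤ b * ∫ α in S, ‖F α‖ ^ 2 ∂ν := by
    intro R S hS hSN
    obtain ⟨g, hg, hgS⟩ := exists_fiberMap_eq_indicator ν hJ hC φ hf hS
    have hmem : ∀ i, MemLp (fun α =>
        (inner ℂ (fibers ν hJ C ψ α i) (fiberMap ν hJ C g α) : ℂ)) 2 ν := by
      intro i
      refine MemLp.of_bound ((stronglyMeasurable_fibers ν hJ ψ i).inner
        (Lp.stronglyMeasurable (fiberMap ν hJ C g))).aestronglyMeasurable (R * R) ?_
      filter_upwards [hgS] with α hα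
      rw [hα]
      by_cases hαS : α ∈ S
      · rw [Set.indicator_of_mem hαS]
        obtain ⟨h1, h2⟩ := hSN hαS
        have h3 : ‖fibers ν hJ C ψ α i‖ ≤ R := Set.mem_iInter.1 h2 i
        have h1' : ‖F α‖ ≤ R := h1
        exact (norm_inner_le_norm _ _).trans (by gcongr)
      · rw [Set.indicator_of_notMem hαS, inner_zero_right, norm_zero]
        positivity
    have h1 := hasSum_norm_sq_inner_system ν hJ hC ψ g hmem
    have h2 : (fun α => ‖coeffs (fibers ν hJ C ψ α) (fiberMap ν hJ C g α)‖ ^ 2) =ᵐ[ν]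
        S.indicator q := by
      filter_upwards [hgS] with α hα
      rw [hα]
      by_cases hαS : α ∈ S
      · rw [Set.indicator_of_mem hαS, Set.indicator_of_mem hαS]
      · rw [Set.indicator_of_notMem hαS, Set.indicator_of_notMem hαS,
          (coeffs_eq_zero_iff _ _).2 (Submodule.zero_mem _)]
        simp
    have h3 : ‖g‖ ^ 2 = ∫ α in S, ‖F α‖ ^ 2 ∂ν := by
      rw [← norm_fiberMap ν hJ hC g, ← integral_norm_sq_Lp, ← integral_indicator hS]
      refine integral_congr_ae ?_
      filter_upwards [hgS] with α hα
      rw [hα]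
      by_cases hαS : α ∈ S
      · rw [Set.indicator_of_mem hαS, Set.indicator_of_mem hαS]
      · rw [Set.indicator_of_notMem hαS, Set.indicator_of_notMem hαS]
        simp
    have h4 := h g hg
    rw [h1.tsum_eq, integral_congr_ae h2, integral_indicator hS, h3] at h4
    refine ⟨?_, h4⟩
    have h5 : Integrable (fun α => ‖coeffs (fibers ν hJ C ψ α) (fiberMap ν hJ C g α)‖ ^ 2) ν := by
      simp_rw [norm_sq_coeffs]
      exact integrable_finsetSum _ fun i _ =>
        (memLp_two_iff_integrable_sq_norm (hmem i).1).1 (hmem i)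
    exact (integrable_indicator_iff hS).1 (h5.congr h2)
  have hFi : Integrable (fun α => ‖F α‖ ^ 2) ν :=
    (memLp_two_iff_integrable_sq_norm (Lp.aestronglyMeasurable F)).1 (Lp.memLp F)
  have hR : ∀ R : ℕ, ∀ᵐ α ∂ν, α ∈ N R → a * ‖F α‖ ^ 2 ≤ q α ∧ q α ≤ b * ‖F α‖ ^ 2 := by
    intro R
    rw [← ae_restrict_iff' (hN R)]
    have hqi : Integrable q (ν.restrict (N R)) := (hbound R _ (hN R) subset_rfl).1
    have h1 : (fun α => a * ‖F α‖ ^ 2) ≤ᵐ[ν.restrict (N R)] q := by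
      refine ae_le_of_forall_setIntegral_le (hFi.restrict.const_mul a) hqi fun S hS _ => ?_
      rw [Measure.restrict_restrict hS, integral_const_mul]
      exact (hbound R _ (hS.inter (hN R)) Set.inter_subset_right).2.1
    have h2 : q ≤ᵐ[ν.restrict (N R)] fun α => b * ‖F α‖ ^ 2 := by
      refine ae_le_of_forall_setIntegral_le hqi (hFi.restrict.const_mul b) fun S hS _ => ?_
      rw [Measure.restrict_restrict hS, integral_const_mul]
      exact (hbound R _ (hS.inter (hN R)) Set.inter_subset_right).2.2
    filter_upwards [h1, h2] with α h3 h4 using ⟨h3, h4⟩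
  filter_upwards [ae_all_iff.2 hR] with α hα
  obtain ⟨R, hR⟩ := exists_nat_ge (‖F α‖ + ∑ i, ‖fibers ν hJ C ψ α i‖)
  refine hα R ⟨?_, Set.mem_iInter.2 fun i => ?_⟩
  · exact le_trans (le_add_of_nonneg_right (Finset.sum_nonneg fun _ _ => norm_nonneg _)) hR
  · have := Finset.single_le_sum (f := fun i => ‖fibers ν hJ C ψ α i‖)
      (fun _ _ => norm_nonneg _) (Finset.mem_univ i)
    exact (this.trans (le_add_of_nonneg_left (norm_nonneg _))).trans hR

/-- The null set must not depend on `v`: use countably many dense coefficient vectors, then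
continuity. -/
theorem ae_forall_frame_bounds (φ : Fin m → Lp ℂ 2 μ) (ψ : Fin k → Lp ℂ 2 μ) {a b : ℝ}
    (h : ∀ v ∈ invariantSpan hJ φ, a * ‖v‖ ^ 2 ≤ ∑' p, ‖inner ℂ (system hJ ψ p) v‖ ^ 2 ∧
      ∑' p, ‖inner ℂ (system hJ ψ p) v‖ ^ 2 ≤ b * ‖v‖ ^ 2) :
    ∀ᵐ α ∂ν, ∀ v ∈ Submodule.span ℂ (Set.range (fibers ν hJ C φ α)),
      a * ‖v‖ ^ 2 ≤ ‖coeffs (fibers ν hJ C ψ α) v‖ ^ 2 ∧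
      ‖coeffs (fibers ν hJ C ψ α) v‖ ^ 2 ≤ b * ‖v‖ ^ 2 := by
  have hV : ∀ c : Fin m → ℂ, ∑ j, c j • φ j ∈ invariantSpan hJ φ := fun c =>
    Submodule.sum_mem _ fun j _ => Submodule.smul_mem _ _ (mem_invariantSpan_self ν hJ hC φ j)
  obtain ⟨Q, hQc, hQd⟩ := TopologicalSpace.exists_countable_dense (Fin m → ℂ)
  have h1 : ∀ᵐ α ∂ν, ∀ c ∈ Q, a * ‖∑ j, c j • fibers ν hJ C φ α j‖ ^ 2 ≤
        ‖coeffs (fibers ν hJ C ψ α) (∑ j, c j • fibers ν hJ C φ α j)‖ ^ 2 ∧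
      ‖coeffs (fibers ν hJ C ψ α) (∑ j, c j • fibers ν hJ C φ α j)‖ ^ 2 ≤
        b * ‖∑ j, c j • fibers ν hJ C φ α j‖ ^ 2 := by
    refine (ae_ball_iff hQc).2 fun c _ => ?_
    filter_upwards [ae_frame_bounds ν hJ hC φ ψ h (hV c), ae_fiberMap_sum ν hJ hC φ c]
      with α h2 h3
    rwa [h3] at h2
  filter_upwards [h1] with α hα v hv
  obtain ⟨c, rfl⟩ := (Submodule.mem_span_range_iff_exists_fun ℂ).1 hv
  have hcont : Continuous fun c : Fin m → ℂ => ∑ j, c j • fibers ν hJ C φ α j := by fun_prop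
  have hcoeff := (continuous_coeffs (fibers ν hJ C ψ α)).comp hcont
  have hclosed : IsClosed {c : Fin m → ℂ | a * ‖∑ j, c j • fibers ν hJ C φ α j‖ ^ 2 ≤
        ‖coeffs (fibers ν hJ C ψ α) (∑ j, c j • fibers ν hJ C φ α j)‖ ^ 2 ∧
      ‖coeffs (fibers ν hJ C ψ α) (∑ j, c j • fibers ν hJ C φ α j)‖ ^ 2 ≤
        b * ‖∑ j, c j • fibers ν hJ C φ α j‖ ^ 2} :=
    (isClosed_le (continuous_const.mul (hcont.norm.pow 2)) (hcoeff.norm.pow 2)).inter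
      (isClosed_le (hcoeff.norm.pow 2) (continuous_const.mul (hcont.norm.pow 2)))
  exact closure_minimal hα hclosed (hQd c)

/-- A bounded family with a fiberwise lower frame bound on `V` has a frame of translates of `V`. -/
theorem isFrameFor_of_ae_lower_bound (φ : Fin m → Lp ℂ 2 μ) (ψ : Fin k → Lp ℂ 2 μ) {a K : ℝ}
    (ha : 0 < a) (hψ : ∀ p, system hJ ψ p ∈ invariantSpan hJ φ)
    (hK : ∀ᵐ α ∂ν, ∀ i, ‖fibers ν hJ C ψ α i‖ ≤ K)
    (h : ∀ᵐ α ∂ν, ∀ v ∈ Submodule.span ℂ (Set.range (fibers ν hJ C φ α)),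
      a * ‖v‖ ^ 2 ≤ ‖coeffs (fibers ν hJ C ψ α) v‖ ^ 2) :
    IsFrameFor (invariantSpan hJ φ) (system hJ ψ) := by
  -- Cauchy–Schwarz over the `k` generators gives `k * K ^ 2`; the maximum ensures that the bounds
  -- are ordered.
  refine ⟨hψ, a, max a (k * K ^ 2), ha, le_max_left _ _, fun f hf => ?_⟩
  set F := fiberMap ν hJ C f
  have hFi : Integrable (fun α => ‖F α‖ ^ 2) ν :=
    (memLp_two_iff_integrable_sq_norm (Lp.aestronglyMeasurable F)).1 (Lp.memLp F)
  have hmem : ∀ i, MemLp (fun α => (inner ℂ (fibers ν hJ C ψ α i) (F α) : ℂ)) 2 ν := by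
    intro i
    refine MemLp.of_le_mul (c := K) (Lp.memLp F) ((stronglyMeasurable_fibers ν hJ ψ i).inner
      (Lp.stronglyMeasurable F)).aestronglyMeasurable ?_
    filter_upwards [hK] with α hα
    exact (norm_inner_le_norm _ _).trans (by gcongr; exact hα i)
  have h1 := hasSum_norm_sq_inner_system ν hJ hC ψ f hmem
  have h5 : Integrable (fun α => ‖coeffs (fibers ν hJ C ψ α) (F α)‖ ^ 2) ν := by
    simp_rw [norm_sq_coeffs]
    exact integrable_finsetSum _ fun i _ =>
      (memLp_two_iff_integrable_sq_norm (hmem i).1).1 (hmem i)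
  have hn : ‖f‖ ^ 2 = ∫ α, ‖F α‖ ^ 2 ∂ν := by
    rw [← norm_fiberMap ν hJ hC f, ← integral_norm_sq_Lp]
  rw [h1.tsum_eq, hn, ← integral_const_mul, ← integral_const_mul]
  refine ⟨h1.summable, integral_mono_ae (hFi.const_mul a) h5 ?_,
    integral_mono_ae h5 (hFi.const_mul _) ?_⟩
  · filter_upwards [h, (mem_invariantSpan_iff_fibers ν hJ hC φ f).1 hf] with α h2 h3
    exact h2 _ h3
  · filter_upwards [hK] with α hα
    calc ‖coeffs (fibers ν hJ C ψ α) (F α)‖ ^ 2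
        = ∑ i, ‖inner ℂ (fibers ν hJ C ψ α i) (F α)‖ ^ 2 := norm_sq_coeffs _ _
      _ ≤ ∑ _i : Fin k, (K * ‖F α‖) ^ 2 := by
        gcongr with i
        exact (norm_inner_le_norm _ _).trans (by gcongr; exact hα i)
      _ = k * K ^ 2 * ‖F α‖ ^ 2 := by simp [mul_pow, mul_assoc]
      _ ≤ max a (k * K ^ 2) * ‖F α‖ ^ 2 := by gcongr; exact le_max_right _ _

theorem isFrameFor_linComb_iff (φ : Fin m → Lp ℂ 2 μ)
    (hφ : IsFrameFor (invariantSpan hJ φ) (system hJ φ)) (A : Matrix (Fin l) (Fin m) ℂ) :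
    IsFrameFor (invariantSpan hJ φ) (system hJ (linComb A φ)) ↔
      (A ∈ generatingMatrices hJ l φ ∧ ∃ δ : ℝ, 0 < δ ∧ ∀ᵐ α ∂ν,
        δ ≤ friedrichsSin (LinearMap.ker (Matrix.toEuclideanLin A))
          (LinearMap.range (Matrix.toEuclideanLin (gramian (fibers ν hJ C φ α))))) := by
  obtain ⟨-, a, b, ha, hab, hfr⟩ := hφ
  have hb : 0 < b := ha.trans_le hab
  have hφα := ae_forall_frame_bounds ν hJ hC φ φ fun v hv => (hfr v hv).2
  constructor
  · rintro ⟨-, a', b', ha', -, hfr'⟩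
    have hψα := ae_forall_frame_bounds ν hJ hC φ (linComb A φ) fun v hv => (hfr' v hv).2
    -- For `y = coeffs φ v`: `‖A y‖ ^ 2 = ‖coeffs ψ v‖ ^ 2 ≥ a' ‖v‖ ^ 2 ≥ (a' / b) ‖y‖ ^ 2`.
    have hlow : ∀ᵐ α ∂ν, ∀ y ∈ LinearMap.range
        (Matrix.toEuclideanLin (gramian (fibers ν hJ C φ α))),
        a' / b * ‖y‖ ^ 2 ≤ ‖Matrix.toEuclideanLin A y‖ ^ 2 := by
      filter_upwards [hφα, hψα, ae_fibers_linComb ν hJ hC φ A] with α h1 h2 h3 y hy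
      obtain ⟨c, rfl⟩ := (mem_range_gramian_iff _ y).1 hy
      have hv : ∑ j, c j • fibers ν hJ C φ α j ∈
          Submodule.span ℂ (Set.range (fibers ν hJ C φ α)) :=
        (Submodule.mem_span_range_iff_exists_fun ℂ).2 ⟨c, rfl⟩
      have h4 := (h2 _ hv).1
      rw [h3] at h4
      rw [toEuclideanLin_coeffs]
      refine le_trans ?_ h4
      rw [div_mul_eq_mul_div, div_le_iff₀ hb, mul_assoc, mul_comm _ b]
      gcongr
      exact (h1 _ hv).2
    have hc : 0 < a' / b := by positivity
    refine ⟨(mem_generatingMatrices_iff ν hJ hC φ A).2 ?_, ?_⟩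
    · filter_upwards [hlow] with α h1
      rw [eq_bot_iff]
      rintro y ⟨hy1, hy2⟩
      have h2 := h1 y hy2
      rw [LinearMap.mem_ker.1 hy1, norm_zero, zero_pow two_ne_zero] at h2
      have h3 : ‖y‖ ^ 2 ≤ 0 := nonpos_of_mul_nonpos_right h2 hc
      rw [Submodule.mem_bot, ← norm_eq_zero]
      exact pow_eq_zero_iff two_ne_zero |>.1 (le_antisymm h3 (sq_nonneg _))
    · obtain ⟨δ, hδ, h⟩ := exists_le_friedrichsSin_of_norm_sq_le (Matrix.toEuclideanLin A) hc
      exact ⟨δ, hδ, hlow.mono fun α hα => h _ hα⟩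
  · rintro ⟨hA, δ, hδ, hsin⟩
    obtain ⟨c, hc, h⟩ := exists_norm_sq_le_of_le_friedrichsSin (Matrix.toEuclideanLin A) hδ
    -- The upper bound at `v = φ j (α)`, keeping only the `j`-th coefficient, reads `‖v‖ ^ 4 ≤ b ‖v‖
    -- ^ 2`.
    have hbdd : ∀ᵐ α ∂ν, ∀ j, ‖fibers ν hJ C φ α j‖ ≤ Real.sqrt b := by
      filter_upwards [hφα] with α h1 j
      have h2 := (h1 _ (Submodule.subset_span ⟨j, rfl⟩)).2
      rw [norm_sq_coeffs] at h2
      have h3 := Finset.single_le_sum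
        (f := fun i => ‖(inner ℂ (fibers ν hJ C φ α i) (fibers ν hJ C φ α j) : ℂ)‖ ^ 2)
        (fun _ _ => sq_nonneg _) (Finset.mem_univ j)
      have h4 : ‖(inner ℂ (fibers ν hJ C φ α j) (fibers ν hJ C φ α j) : ℂ)‖ =
          ‖fibers ν hJ C φ α j‖ ^ 2 := by
        rw [inner_self_eq_norm_sq_to_K]
        simp
      simp only [h4] at h3
      apply Real.le_sqrt_of_sq_le
      by_contra! h5
      have h6 := h3.trans h2
      nlinarith
    -- `c` comes from the angle and `a` from the frame `φ`; `K` is a crude triangle-inequality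
    -- bound.
    refine isFrameFor_of_ae_lower_bound ν hJ hC φ (linComb A φ)
      (a := c * a) (K := ∑ i, ∑ j, ‖A i j‖ * Real.sqrt b) (by positivity) ?_ ?_ ?_
    · intro p
      have hA' : invariantSpan hJ (linComb A φ) = invariantSpan hJ φ := hA
      rw [← hA']
      exact system_mem_invariantSpan hJ _ p
    · filter_upwards [hbdd, ae_fibers_linComb ν hJ hC φ A] with α h1 h2 i
      rw [h2]
      have h3 : ∀ i, 0 ≤ ∑ j, ‖A i j‖ * Real.sqrt b := fun i =>
        Finset.sum_nonneg fun j _ => by positivity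
      refine le_trans ?_ (Finset.single_le_sum (fun i _ => h3 i) (Finset.mem_univ i))
      refine norm_sum_le_of_le _ fun j _ => ?_
      rw [norm_smul]
      gcongr
      exact h1 j
    · filter_upwards [hφα, hsin, (mem_generatingMatrices_iff ν hJ hC φ A).1 hA,
        ae_fibers_linComb ν hJ hC φ A] with α h1 h2 h3 h4 v hv
      rw [h4, ← toEuclideanLin_coeffs]
      obtain ⟨d, hd⟩ := (Submodule.mem_span_range_iff_exists_fun ℂ).1 hv
      refine le_trans ?_ (h _ h3 h2 _ ((mem_range_gramian_iff _ _).2 ⟨d, by rw [hd]⟩))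
      rw [mul_assoc]
      gcongr
      exact (h1 v hv).1

end FrameBounds

end TranslateSystem

end

theorem theorem4p7 {Γ X : Type*} [CommGroup Γ] [TopologicalSpace Γ] [DiscreteTopology Γ]
    [Countable Γ] [MeasurableSpace (PontryaginDual Γ)] [BorelSpace (PontryaginDual Γ)]
    (ν : Measure (PontryaginDual Γ)) [ν.IsHaarMeasure] [IsProbabilityMeasure ν]
    [MeasurableSpace X] (μ : Measure X) [SigmaFinite μ]
    [MulAction Γ X] [MeasurableConstSMul Γ X]
    {J : Γ → X → ℝ≥0} (hJ : TranslateSystem.IsJacobian μ J)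
    {C : Set X} (hC : IsFundamentalDomain Γ C μ)
    {m l : ℕ} (φ : Fin m → Lp ℂ 2 μ)
    (hl : TranslateSystem.miLength (Set.range (TranslateSystem.dualChar (Γ := Γ) ν))
      (TranslateSystem.fiberMap ν hJ C '' (TranslateSystem.invariantSpan hJ φ : Set (Lp ℂ 2 μ)))
        ≤ (l : ℕ∞))
    (hlm : l ≤ m) :
    (∀ᵐ A : Fin l → Fin m → ℂ, Matrix.of A ∈ TranslateSystem.generatingMatrices hJ l φ) ∧
    (TranslateSystem.IsFrameFor (TranslateSystem.invariantSpan hJ φ)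
        (TranslateSystem.system hJ φ) →
      ∀ A : Matrix (Fin l) (Fin m) ℂ,
        TranslateSystem.IsFrameFor (TranslateSystem.invariantSpan hJ φ)
            (TranslateSystem.system hJ (TranslateSystem.linComb A φ)) ↔
          (A ∈ TranslateSystem.generatingMatrices hJ l φ ∧
            ∃ δ : ℝ, 0 < δ ∧ ∀ᵐ α ∂ν,
              δ ≤ TranslateSystem.friedrichsSin
                (LinearMap.ker (Matrix.toEuclideanLin A))
                (LinearMap.range (Matrix.toEuclideanLin
                  (TranslateSystem.gramian
                    fun j => TranslateSystem.fiberMap ν hJ C (φ j) α))))) := by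
  exact ⟨TranslateSystem.ae_mem_generatingMatrices ν hJ hC φ hl,
    fun hφ A => TranslateSystem.isFrameFor_linComb_iff ν hJ hC φ hφ A⟩
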